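/- Let $d\ge 3$ and $\rho>0$. Let $G(x)=(G_{jk}(x))$ be a smooth function on $\mathbb R^d$ with values in the positive definite symmetric real $d\times d$ matrices and let $a\in C^\infty(\mathbb R^d)$ be real valued with $a\ge 0$, such that for all $j,k$ and all $\alpha\in\mathbb N^d$ there is $c_\alpha$ with $$|\partial^\alpha(G_{jk}(x)-\delta_{jk})|\le c_\alpha\langle x\rangle^{-\rho-|\alpha|},\qquad |\partial^\alpha a(x)|\le c_\alpha\langle x\rangle^{-1-\rho-|\alpha|}\qquad(x\in\mathbb R^d),$$ where $\langle x\rangle=(1+|x|^2)^{1/2}$. Let $H_0=-\operatorname{div}(G\nabla)$, acting on tempered distributions. For $\operatorname{Im}z>0$ let $R(z)=(H_0-iza-z^2)^{-1}$ be the inverse of the operator $H_0-iza-z^2$ with domain $H^2(\mathbb R^d)$ on $L^2(\mathbb R^d)$; it is a well-defined bounded operator on $L^2$. Let $\mathcal H=\dot H^1\times L^2$, where $\dot H^1=\{u\in L^{2d/(d-2)}:\nabla u\in L^2\}$, with the norm $$\|(u,v)\|_{\mathcal H}^2=\|H_0^{1/2}u\|_{L^2}^2+\|v\|_{L^2}^2,\qquad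 \|H_0^{1/2}u\|_{L^2}^2=\langle G\nabla u,\nabla u\rangle_{L^2} ;$$ this is a Hilbert space in which $\mathcal S(\mathbb R^d)\times\mathcal S(\mathbb R^d)$ is dense, that is, the Hilbert completion of $\mathcal S\times\mathcal S$ for this norm. Let $$\mathcal A=\begin{pmatrix}0&I\\ H_0&-ia\end{pmatrix},\qquad \mathcal D(\mathcal A)=\{(u,v)\in\mathcal H : (v,H_0u)\in\mathcal H\},$$ where $H_0u$ is taken in the sense of tempered distributions, and equip $\mathcal D(\mathcal A)$ with the norm $\|(u,v)\|_{\mathcal H}+\|H_0u\|_{L^2}+\|H_0^{1/2}v\|_{L^2}$. Then: (i) For all $z\in\mathbb C$ with $\operatorname{Im}z>0$, the operator $$\begin{pmatrix}R(z)(ia+z)&R(z)\\ I+R(z)(zia+z^2)&zR(z)\end{pmatrix},$$ defined on $\mathcal S(\mathbb R^d)\times\mathcal S(\mathbb R^d)$, has a closure which is a bounded operator from $\mathcal H$ to $\mathcal D(\mathcal A)$; it is denoted by $\mathcal R_{\mathcal A}(z)$. (ii) The operator $\mathcal A$ is maximal dissipative on $\mathcal H$: $\operatorname{Im}\langle\mathcal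 A\varphi,\varphi\rangle_{\mathcal H}\le 0$ for all $\varphi\in\mathcal D(\mathcal A)$ (with the inner product antilinear on the right), and $\mathcal A$ has no other dissipative extension on $\mathcal H$ than itself. Moreover, for all $z$ with $\operatorname{Im}z>0$, $\mathcal R_{\mathcal A}(z)$ is the two-sided inverse of $\mathcal A-z$, i.e. $(\mathcal A-z)^{-1}=\mathcal R_{\mathcal A}(z)$. -/

import Mathlib

open MeasureTheory SchwartzMap TemperedDistribution LineDeriv
open scoped ENNReal ContDiff

noncomputable section

namespace DampedWave

/-- Euclidean space `ℝ^d`. -/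
abbrev Space (d : ℕ) : Type := EuclideanSpace ℝ (Fin d)

/-- The complex Hilbert space `L²(ℝ^d)`. -/
abbrev L2 (d : ℕ) : Type := Lp ℂ 2 (volume : Measure (Space d))

/-- The `j`-th vector of the canonical basis of `ℝ^d`. -/
abbrev basisVec {d : ℕ} (j : Fin d) : Space d := EuclideanSpace.single j 1

/-- `⟨x⟩ = (1 + |x|²)^{1/2}`. -/
def bracket {d : ℕ} (x : Space d) : ℝ := Real.sqrt (1 + ‖x‖ ^ 2)

/-- The coefficients of the damped wave equation: a long range metric perturbation `G` of the
identity and a short range absorption index `a ≥ 0`. The size of the `n`-th Fréchet derivative at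
`x` is comparable to the largest of the `|∂^α|` with `|α| = n`. -/
structure Medium (d : ℕ) where
  /-- the matrix `G(x)` -/
  G : Space d → Matrix (Fin d) (Fin d) ℝ
  /-- the absorption index -/
  a : Space d → ℝ
  /-- the rate of decay -/
  ρ : ℝ
  ρ_pos : 0 < ρ
  G_posDef : ∀ x, (G x).PosDef
  G_smooth : ∀ j k, ContDiff ℝ ∞ (fun x => G x j k)
  G_longRange : ∀ j k, ∀ n : ℕ, ∃ c : ℝ, ∀ x,
    ‖iteratedFDeriv ℝ n (fun y => G y j k - if j = k then 1 else 0) x‖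
      ≤ c * bracket x ^ (-ρ - n)
  a_nonneg : ∀ x, 0 ≤ a x
  a_smooth : ContDiff ℝ ∞ a
  a_shortRange : ∀ n : ℕ, ∃ c : ℝ, ∀ x,
    ‖iteratedFDeriv ℝ n a x‖ ≤ c * bracket x ^ (-1 - ρ - n)

/-! ### Elementary facts: bounded coefficients -/

theorem one_le_bracket {d : ℕ} (x : Space d) : 1 ≤ bracket x := by
  unfold bracket
  rw [Real.one_le_sqrt]
  nlinarith [sq_nonneg ‖x‖]

theorem bounded_of_decay {d : ℕ} {f : Space d → ℝ} {c s : ℝ} (hs : s ≤ 0)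
    (h : ∀ x, ‖f x‖ ≤ c * bracket x ^ s) (x : Space d) : ‖f x‖ ≤ |c| := by
  have h1 : bracket x ^ s ≤ 1 := Real.rpow_le_one_of_one_le_of_nonpos (one_le_bracket x) hs
  have h0 : 0 ≤ bracket x ^ s := Real.rpow_nonneg (le_trans zero_le_one (one_le_bracket x)) s
  calc ‖f x‖ ≤ c * bracket x ^ s := h x
    _ ≤ |c| * bracket x ^ s := mul_le_mul_of_nonneg_right (le_abs_self c) h0
    _ ≤ |c| * 1 := mul_le_mul_of_nonneg_left h1 (abs_nonneg c)
    _ = |c| := mul_one _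

namespace Medium

variable {d : ℕ} (M : Medium d)

theorem memLp_G (j k : Fin d) :
    MemLp (fun x => (M.G x j k : ℂ)) ∞ (volume : Measure (Space d)) := by
  obtain ⟨c, hc⟩ := M.G_longRange j k 0
  have hb := bounded_of_decay (f := fun y => M.G y j k - if j = k then 1 else 0) (c := c)
    (s := -M.ρ) (by linarith [M.ρ_pos]) (fun x => by simpa using hc x)
  refine memLp_top_of_bound (C := |c| + 1) ?_ (Filter.Eventually.of_forall fun x => ?_)
  · exact (Complex.continuous_ofReal.comp (M.G_smooth j k).continuous).aestronglyMeasurable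
  · have h1 : ‖(if j = k then (1 : ℝ) else 0)‖ ≤ 1 := by split_ifs <;> simp
    have h2 := norm_add_le (M.G x j k - if j = k then 1 else 0) (if j = k then (1 : ℝ) else 0)
    rw [sub_add_cancel] at h2
    rw [Complex.norm_real]
    linarith [hb x]

theorem memLp_a : MemLp (fun x => (M.a x : ℂ)) ∞ (volume : Measure (Space d)) := by
  obtain ⟨c, hc⟩ := M.a_shortRange 0
  have hb := bounded_of_decay (f := M.a) (c := c)
    (s := -1 - M.ρ) (by linarith [M.ρ_pos]) (fun x => by simpa using hc x)
  refine memLp_top_of_bound (C := |c|) ?_ (Filter.Eventually.of_forall fun x => ?_)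
  · exact (Complex.continuous_ofReal.comp M.a_smooth.continuous).aestronglyMeasurable
  · rw [Complex.norm_real]
    exact hb x

end Medium

/-- Multiplication by a bounded function, as a bounded operator on `L²`. -/
def mulL2 {d : ℕ} (g : Space d → ℂ) (hg : MemLp g ∞ (volume : Measure (Space d))) :
    L2 d →L[ℂ] L2 d :=
  (ContinuousLinearMap.mul ℂ ℂ).holderL volume ∞ 2 2 hg.toLp

theorem mulL2_coeFn {d : ℕ} (g : Space d → ℂ) (hg : MemLp g ∞ (volume : Measure (Space d)))
    (f : L2 d) : mulL2 g hg f =ᵐ[volume] fun x => g x * f x := by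
  have h := (ContinuousLinearMap.mul ℂ ℂ).coeFn_holder (r := 2) hg.toLp f
  filter_upwards [h, hg.coeFn_toLp] with x hx hx'
  simpa [mulL2, hx'] using hx

/-- Multiplication by the entry `G_{jk}`, on `L²`. -/
def Medium.mulG {d : ℕ} (M : Medium d) (j k : Fin d) : L2 d →L[ℂ] L2 d :=
  mulL2 (fun x => (M.G x j k : ℂ)) (M.memLp_G j k)

/-- Multiplication by the absorption index `a`, on `L²`. -/
def Medium.mulA {d : ℕ} (M : Medium d) : L2 d →L[ℂ] L2 d :=
  mulL2 (fun x => (M.a x : ℂ)) M.memLp_a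

/-- The operator `H₀ = - div (G ∇) = - ∑_{j,k} ∂_j G_{jk} ∂_k` on tempered distributions. -/
def Medium.H0 {d : ℕ} (M : Medium d) : 𝓢'(Space d, ℂ) →L[ℂ] 𝓢'(Space d, ℂ) :=
  -∑ j, ∑ k, lineDerivOpCLM ℂ 𝓢'(Space d, ℂ) (basisVec j) ∘L
    smulLeftCLM ℂ (fun x => (M.G x j k : ℂ)) ∘L lineDerivOpCLM ℂ 𝓢'(Space d, ℂ) (basisVec k)

/-! ### The resolvent `R(z)` -/

/-- `R` is the bounded inverse on `L²` of the operator `H₀ - i z a - z²` with domain `H²`. -/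
def Medium.IsInverse {d : ℕ} (M : Medium d) (z : ℂ) (R : L2 d →L[ℂ] L2 d) : Prop :=
  ∀ f u : L2 d, R f = u ↔ MemSobolev 2 2 (u : 𝓢'(Space d, ℂ)) ∧
    M.H0 (u : 𝓢'(Space d, ℂ)) - ((Complex.I * z) • M.mulA u + z ^ 2 • u : L2 d)
      = (f : 𝓢'(Space d, ℂ))

open Classical in
/-- `R(z) = (H₀ - i z a - z²)⁻¹`, the inverse of the operator with domain `H²` on `L²`
(and `0` for those `z` for which there is no bounded inverse). -/
def Medium.R {d : ℕ} (M : Medium d) (z : ℂ) : L2 d →L[ℂ] L2 d :=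
  if h : ∃ R : L2 d →L[ℂ] L2 d, M.IsInverse z R then h.choose else 0

/-! ### `L²` inside the tempered distributions -/

/-- The embedding of `L²` in the space of tempered distributions. -/
def l2Emb (d : ℕ) : L2 d →ₗ[ℂ] 𝓢'(Space d, ℂ) :=
  (Lp.toTemperedDistributionCLM ℂ (volume : Measure (Space d)) 2 : L2 d →L[ℂ] 𝓢'(Space d, ℂ))

theorem lp_toTemperedDistribution_injective {d : ℕ} (p : ℝ≥0∞) [Fact (1 ≤ p)] :
    Function.Injective
      (Lp.toTemperedDistributionCLM ℂ (volume : Measure (Space d)) p) :=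
  LinearMap.ker_eq_bot.mp (Lp.ker_toTemperedDistributionCLM_eq_bot (F := ℂ)
    (μ := (volume : Measure (Space d))) (p := p))

theorem l2Emb_injective (d : ℕ) : Function.Injective (l2Emb d) :=
  lp_toTemperedDistribution_injective 2

/-- The `L²` function which represents a distribution belonging to `L²`. -/
def l2Rep (d : ℕ) : LinearMap.range (l2Emb d) →ₗ[ℂ] L2 d :=
  (LinearEquiv.ofInjective (l2Emb d) (l2Emb_injective d)).symm.toLinearMap

theorem l2Emb_l2Rep {d : ℕ} (u : LinearMap.range (l2Emb d)) : l2Emb d (l2Rep d u) = u := by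
  have h := (LinearEquiv.ofInjective (l2Emb d) (l2Emb_injective d)).apply_symm_apply u
  exact congrArg Subtype.val h

/-! ### The homogeneous Sobolev space -/

/-- The Sobolev exponent `2d / (d - 2)`. -/
def sobolevExp (d : ℕ) : ℝ≥0∞ := ENNReal.ofReal (2 * d / (d - 2))

instance one_le_sobolevExp (d : ℕ) [hd : Fact (3 ≤ d)] : Fact (1 ≤ sobolevExp d) := by
  have h3 : (3 : ℝ) ≤ d := by exact_mod_cast hd.out
  refine ⟨?_⟩
  unfold sobolevExp
  rw [← ENNReal.ofReal_one]
  refine ENNReal.ofReal_le_ofReal ?_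
  rw [le_div_iff₀ (by linarith)]
  linarith

/-- `Ḣ¹ = {u ∈ L^{2d/(d-2)} | ∇u ∈ L²}`, as a space of tempered distributions. -/
def hdot (d : ℕ) [Fact (3 ≤ d)] : Submodule ℂ 𝓢'(Space d, ℂ) where
  carrier := {u | (∃ f : Lp ℂ (sobolevExp d) (volume : Measure (Space d)), u = f) ∧
    ∀ j : Fin d, ∃ g : L2 d, ∂_{basisVec j} u = (g : 𝓢'(Space d, ℂ))}
  zero_mem' := by
    refine ⟨⟨0, ?_⟩, fun j => ⟨0, ?_⟩⟩
    · exact (map_zero (Lp.toTemperedDistributionCLM ℂ volume (sobolevExp d))).symm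
    · exact ((lineDerivOpCLM ℂ 𝓢'(Space d, ℂ) (basisVec j)).map_zero).trans
        (map_zero (l2Emb d)).symm
  add_mem' := by
    rintro u w ⟨⟨f, hf⟩, hu⟩ ⟨⟨g, hg⟩, hw⟩
    refine ⟨⟨f + g, ?_⟩, fun j => ?_⟩
    · rw [hf, hg]
      exact (map_add (Lp.toTemperedDistributionCLM ℂ volume (sobolevExp d)) f g).symm
    · obtain ⟨f', hf'⟩ := hu j
      obtain ⟨g', hg'⟩ := hw j
      refine ⟨f' + g', ?_⟩
      rw [lineDerivOp_add, hf', hg']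
      exact (map_add (l2Emb d) f' g').symm
  smul_mem' := by
    rintro c u ⟨⟨f, hf⟩, hu⟩
    refine ⟨⟨c • f, ?_⟩, fun j => ?_⟩
    · rw [hf]
      exact (map_smul (Lp.toTemperedDistributionCLM ℂ volume (sobolevExp d)) c f).symm
    · obtain ⟨f', hf'⟩ := hu j
      refine ⟨c • f', ?_⟩
      rw [lineDerivOp_smul, hf']
      exact (map_smul (l2Emb d) c f').symm

theorem schwartz_mem_hdot {d : ℕ} [Fact (3 ≤ d)] (f : 𝓢(Space d, ℂ)) :
    (f : 𝓢'(Space d, ℂ)) ∈ hdot d := by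
  refine ⟨⟨f.toLp (sobolevExp d), ?_⟩, fun j => ⟨(∂_{basisVec j} f).toLp 2, ?_⟩⟩
  · rw [Lp.toTemperedDistribution_toLp_eq]
  · rw [Lp.toTemperedDistribution_toLp_eq, lineDerivOp_toTemperedDistributionCLM_eq]

/-! ### A function in `L^p`, `p < ∞`, whose gradient vanishes is zero -/

section Liouville

open scoped Convolution
open ContinuousLinearMap (lsmul)

variable {d : ℕ} {p : ℝ≥0∞} [hp : Fact (1 ≤ p)]

theorem integral_translate_const (u : Lp ℂ p (volume : Measure (Space d)))
    (hu : ∀ j : Fin d, ∂_{basisVec j} (u : 𝓢'(Space d, ℂ)) = 0)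
    (g : Space d → ℝ) (hg : ContDiff ℝ ∞ g) (hgc : HasCompactSupport g) (x y : Space d) :
    ∫ t, g (x - t) • u t = ∫ t, g (y - t) • u t := by
  let L : ℂ →L[ℝ] ℝ →L[ℝ] ℂ := (lsmul ℝ ℝ).flip
  have hloc : LocallyIntegrable u (volume : Measure (Space d)) :=
    (Lp.memLp u).locallyIntegrable hp.out
  have hg1 : ContDiff ℝ 1 g := hg.of_le (by exact_mod_cast le_top)
  have hd := fun x₀ => hgc.hasFDerivAt_convolution_right L hloc hg1 x₀
  have key : ∀ x₀, (u ⋆[L.precompR (Space d), volume] fderiv ℝ g) x₀ = 0 := by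
    intro x₀
    have hz : ∀ j : Fin d,
        (u ⋆[L.precompR (Space d), volume] fderiv ℝ g) x₀ (basisVec j) = 0 := by
      intro j
      rw [convolution_precompR_apply L hloc (hgc.fderiv ℝ) (hg1.continuous_fderiv one_ne_zero)]
      have hψ1 : HasCompactSupport (fun t => (g (x₀ - t) : ℂ)) := by
        have h1 : HasCompactSupport (g ∘ (Homeomorph.subLeft x₀)) :=
          hgc.comp_homeomorph (Homeomorph.subLeft x₀)
        exact h1.comp_left (g := fun r : ℝ => (r : ℂ)) (by simp)
      have hψ2 : ContDiff ℝ ∞ (fun t => (g (x₀ - t) : ℂ)) :=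
        Complex.ofRealCLM.contDiff.comp (hg.comp (contDiff_const.sub contDiff_id))
      have h0 := congrArg (fun T : 𝓢'(Space d, ℂ) => T (hψ1.toSchwartzMap hψ2)) (hu j)
      simp only [lineDerivOp_apply_apply, Lp.toTemperedDistribution_apply] at h0
      rw [convolution_def]
      refine Eq.trans (integral_congr_ae (Filter.Eventually.of_forall fun t => ?_)) h0
      have hder : HasFDerivAt (fun t => (g (x₀ - t) : ℂ))
          (Complex.ofRealCLM.comp ((fderiv ℝ g (x₀ - t)).comp (-ContinuousLinearMap.id ℝ _))) t :=
        Complex.ofRealCLM.hasFDerivAt.comp t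
          (((hg1.differentiable one_ne_zero) (x₀ - t)).hasFDerivAt.comp t
            ((hasFDerivAt_id t).const_sub x₀))
      have hval : (-∂_{basisVec j} (hψ1.toSchwartzMap hψ2)) t
          = ((fderiv ℝ g (x₀ - t) (basisVec j) : ℝ) : ℂ) := by
        change -((∂_{basisVec j} (hψ1.toSchwartzMap hψ2)) t) = _
        rw [SchwartzMap.lineDerivOp_apply_eq_fderiv]
        have : fderiv ℝ (⇑(hψ1.toSchwartzMap hψ2)) t = _ := hder.fderiv
        rw [this]
        simp
      simp only [hval]
      simp [L]
    ext v
    have hb : ∑ j, v j • (basisVec j : Space d) = v := by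
      simpa using (EuclideanSpace.basisFun (Fin d) ℝ).sum_repr v
    rw [← hb, map_sum]
    simp only [map_smul, hz]
    simp
  have hconst := is_const_of_fderiv_eq_zero (𝕜 := ℝ) (f := u ⋆[L, volume] g)
    (fun x₀ => (hd x₀).differentiableAt) (fun x₀ => by rw [(hd x₀).fderiv, key]) x y
  simpa [convolution_def, L] using hconst

theorem eq_zero_of_grad_eq_zero [NeZero d] (hpt : p ≠ (⊤ : ℝ≥0∞))
    (u : Lp ℂ p (volume : Measure (Space d)))
    (hu : ∀ j : Fin d, ∂_{basisVec j} (u : 𝓢'(Space d, ℂ)) = 0) : u = 0 := by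
  rw [Lp.eq_zero_iff_ae_eq_zero]
  refine ae_eq_zero_of_integral_contDiff_smul_eq_zero
    ((Lp.memLp u).locallyIntegrable hp.out) fun g₀ hg₀ hgc₀ => ?_
  -- reflected test function
  have hg : ContDiff ℝ ∞ (fun t => g₀ (-t)) := hg₀.comp contDiff_neg
  have hgc : HasCompactSupport (fun t => g₀ (-t)) :=
    hgc₀.comp_homeomorph (Homeomorph.neg (Space d))
  set g : Space d → ℝ := fun t => g₀ (-t) with hgdef
  have h0 : ∫ t, g₀ t • u t = ∫ t, g (0 - t) • u t := by simp [hgdef]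
  rw [h0]
  have hpq := ENNReal.HolderConjugate.inv_one_sub_inv' hp.out
  set q : ℝ≥0∞ := (1 - p⁻¹)⁻¹ with hq
  have hgq : eLpNorm g q volume ≠ ⊤ :=
    (hg.continuous.memLp_of_hasCompactSupport hgc).eLpNorm_ne_top
  have hbound : ∀ ε : ℝ≥0∞, ε ≠ 0 → ‖∫ t, g (0 - t) • u t‖ₑ ≤ eLpNorm g q volume * ε := by
    intro ε hε
    obtain ⟨v, hvc, hv, hvcont, hvm⟩ :=
      (Lp.memLp u).exists_hasCompactSupport_eLpNorm_sub_le hpt hε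
    -- a point where the translated test function does not meet the support of `v`
    obtain ⟨x, hx⟩ : ∃ x : Space d, ∀ t, g (x - t) * ‖v t‖ = 0 := by
      obtain ⟨A, hA⟩ := hgc.isCompact.isBounded.exists_norm_le
      obtain ⟨B, hB⟩ := hvc.isCompact.isBounded.exists_norm_le
      refine ⟨EuclideanSpace.single 0 (|A| + |B| + 1), fun t => ?_⟩
      by_contra hne
      have hne' := mul_ne_zero_iff.mp hne
      have h1 := hA _ (subset_tsupport _ (Function.mem_support.mpr hne'.1))
      have h2 := hB _ (subset_tsupport _ (Function.mem_support.mpr (norm_ne_zero_iff.mp hne'.2)))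
      have h3 : ‖(EuclideanSpace.single 0 (|A| + |B| + 1) : Space d)‖ = |A| + |B| + 1 := by
        rw [PiLp.norm_single, Real.norm_eq_abs, abs_of_nonneg (by positivity)]
      have h4 := norm_add_le ((EuclideanSpace.single 0 (|A| + |B| + 1) : Space d) - t) t
      rw [sub_add_cancel, h3] at h4
      linarith [le_abs_self A, le_abs_self B]
    rw [integral_translate_const u hu g hg hgc 0 x]
    have hcongr : ∀ t, g (x - t) • u t = g (x - t) • (⇑u - v) t := by
      intro t
      have : g (x - t) • v t = 0 := by
        rcases mul_eq_zero.mp (hx t) with h | h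
        · simp [h]
        · simp [norm_eq_zero.mp h]
      rw [Pi.sub_apply, smul_sub, this, sub_zero]
    simp only [hcongr]
    refine (enorm_integral_le_lintegral_enorm _).trans ?_
    rw [← eLpNorm_one_eq_lintegral_enorm]
    have hqp : ENNReal.HolderTriple q p 1 := hpq.symm
    have hmeas : AEStronglyMeasurable (fun t => g (x - t)) (volume : Measure (Space d)) :=
      (hg.continuous.comp (continuous_const.sub continuous_id)).aestronglyMeasurable
    have hH := eLpNorm_smul_le_mul_eLpNorm (p := q) (q := p) (r := 1)
      ((Lp.memLp u).sub hvm).aestronglyMeasurable hmeas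
    refine hH.trans (mul_le_mul' (le_of_eq ?_) hv)
    exact eLpNorm_comp_measurePreserving (g := g) hg.continuous.aestronglyMeasurable
      (Measure.measurePreserving_sub_left volume x)
  rw [← enorm_eq_zero]
  by_contra hne
  have hpos : ‖∫ t, g (0 - t) • u t‖ₑ ≠ 0 := hne
  by_cases hgz : eLpNorm g q volume = 0
  · have := hbound 1 one_ne_zero
    rw [hgz, zero_mul] at this
    exact hpos (le_antisymm this zero_le)
  · have hfin : ‖∫ t, g (0 - t) • u t‖ₑ ≠ ⊤ := enorm_ne_top
    have hε : ‖∫ t, g (0 - t) • u t‖ₑ / (2 * eLpNorm g q volume) ≠ 0 :=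
      (ENNReal.div_pos hpos (ENNReal.mul_ne_top (by simp) hgq)).ne'
    have h1 := hbound _ hε
    have h2 : eLpNorm g q volume * (‖∫ t, g (0 - t) • u t‖ₑ / (2 * eLpNorm g q volume))
        = ‖∫ t, g (0 - t) • u t‖ₑ / 2 := by
      rw [mul_comm 2, ← ENNReal.mul_div_mul_left (‖∫ t, g (0 - t) • u t‖ₑ) 2 hgz hgq,
        mul_div_assoc]
    rw [h2] at h1
    exact absurd h1 (not_le.mpr (ENNReal.half_lt_self hpos hfin))

end Liouville

theorem eq_zero_of_mem_hdot {d : ℕ} [hd : Fact (3 ≤ d)] {u : 𝓢'(Space d, ℂ)} (hu : u ∈ hdot d)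
    (h : ∀ j : Fin d, ∂_{basisVec j} u = 0) : u = 0 := by
  obtain ⟨⟨f, rfl⟩, -⟩ := hu
  have : NeZero d := ⟨by have := hd.out; omega⟩
  rw [eq_zero_of_grad_eq_zero (p := sobolevExp d) ENNReal.ofReal_ne_top f h]
  exact map_zero (Lp.toTemperedDistributionCLM ℂ volume (sobolevExp d))

theorem inner_mulG {d : ℕ} (M : Medium d) (j k : Fin d) (f g : L2 d) :
    inner ℂ f (M.mulG j k g) = ∫ x, (M.G x j k : ℂ) * (g x * star (f x)) := by
  rw [L2.inner_def]
  refine integral_congr_ae ?_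
  filter_upwards [mulL2_coeFn _ (M.memLp_G j k) g] with x hx
  rw [Medium.mulG, hx, RCLike.inner_apply, starRingEnd_apply]
  ring

theorem integrable_mulG {d : ℕ} (M : Medium d) (j k : Fin d) (f g : L2 d) :
    Integrable (fun x => (M.G x j k : ℂ) * (g x * star (f x))) := by
  have h := L2.integrable_inner (𝕜 := ℂ) f (M.mulG j k g)
  refine h.congr ?_
  filter_upwards [mulL2_coeFn _ (M.memLp_G j k) g] with x hx
  rw [Medium.mulG, hx, RCLike.inner_apply, starRingEnd_apply]
  ring

theorem G_symm {d : ℕ} (M : Medium d) (x : Space d) (j k : Fin d) : M.G x j k = M.G x k j := by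
  have h := (M.G_posDef x).isHermitian.apply k j
  simpa using h

/-- The Hermitian form of `G(x)` on `ℂ^d`, through the real form. -/
theorem quad_eq {d : ℕ} (M : Medium d) (x : Space d) (w : Fin d → ℂ) :
    ∑ j, ∑ k, (M.G x j k : ℂ) * (w k * star (w j)) =
      (((fun j => (w j).re) ⬝ᵥ (M.G x).mulVec (fun j => (w j).re)
        + (fun j => (w j).im) ⬝ᵥ (M.G x).mulVec (fun j => (w j).im) : ℝ) : ℂ) := by
  apply Complex.ext
  · simp only [Complex.re_sum, Complex.ofReal_re, dotProduct, Matrix.mulVec, Finset.mul_sum,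
      ← Finset.sum_add_distrib]
    refine Finset.sum_congr rfl fun j _ => Finset.sum_congr rfl fun k _ => ?_
    simp
    ring
  · simp only [Complex.im_sum, Complex.ofReal_im]
    have hanti : ∑ j, ∑ k, ((M.G x j k : ℂ) * (w k * star (w j))).im
        = -∑ j, ∑ k, ((M.G x j k : ℂ) * (w k * star (w j))).im := by
      conv_rhs => rw [Finset.sum_comm]
      rw [← Finset.sum_neg_distrib]
      refine Finset.sum_congr rfl fun j _ => ?_
      rw [← Finset.sum_neg_distrib]
      refine Finset.sum_congr rfl fun k _ => ?_
      rw [G_symm M x k j]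
      simp
      ring
    linarith

theorem inner_sum_eq {d : ℕ} (M : Medium d) (F : Fin d → L2 d) :
    ∑ j, ∑ k, inner ℂ (F j) (M.mulG j k (F k)) =
      ((∫ x, ((fun j => (F j x).re) ⬝ᵥ (M.G x).mulVec (fun j => (F j x).re)
        + (fun j => (F j x).im) ⬝ᵥ (M.G x).mulVec (fun j => (F j x).im)) : ℝ) : ℂ) := by
  simp only [inner_mulG]
  refine Eq.trans ?_ integral_ofReal
  simp only [← integral_finsetSum Finset.univ (fun k _ => integrable_mulG M _ k _ _)]
  rw [← integral_finsetSum Finset.univ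
    (fun j _ => integrable_finsetSum Finset.univ (fun k _ => integrable_mulG M j k _ _))]
  exact integral_congr_ae (Filter.Eventually.of_forall fun x => quad_eq M x (fun j => F j x))

theorem quad_nonneg {d : ℕ} (M : Medium d) (x : Space d) (v : Fin d → ℝ) :
    0 ≤ v ⬝ᵥ (M.G x).mulVec v := by
  simpa using (M.G_posDef x).posSemidef.dotProduct_mulVec_nonneg v

theorem mulG_conj {d : ℕ} (M : Medium d) (j k : Fin d) (f g : L2 d) :
    star (inner ℂ g (M.mulG j k f)) = inner ℂ f (M.mulG k j g) := by
  rw [inner_mulG, inner_mulG, ← starRingEnd_apply, ← integral_conj]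
  refine integral_congr_ae (Filter.Eventually.of_forall fun x => ?_)
  simp [G_symm M x j k, mul_comm]

/-- The space `Ḣ¹`, which carries the norm `‖H₀^{1/2} u‖ = ⟨G ∇u, ∇u⟩^{1/2}` given by `G`. -/
def HDot {d : ℕ} [Fact (3 ≤ d)] (_ : Medium d) : Type := hdot d

section HDot

variable {d : ℕ} [Fact (3 ≤ d)] {M : Medium d}

instance : AddCommGroup (HDot M) := inferInstanceAs (AddCommGroup (hdot d))

instance : Module ℂ (HDot M) := inferInstanceAs (Module ℂ (hdot d))

/-- An element of `Ḣ¹`, as a distribution. -/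
def HDot.dist : HDot M →ₗ[ℂ] 𝓢'(Space d, ℂ) := (hdot d).subtype

theorem HDot.dist_mem (u : HDot M) : u.dist ∈ hdot d := u.property

theorem HDot.dist_injective : Function.Injective (HDot.dist : HDot M → 𝓢'(Space d, ℂ)) :=
  Subtype.val_injective

/-- The partial derivative `∂_j u ∈ L²` of `u ∈ Ḣ¹`. -/
def HDot.partialDeriv (j : Fin d) : HDot M →ₗ[ℂ] L2 d :=
  l2Rep d ∘ₗ LinearMap.codRestrict (LinearMap.range (l2Emb d))
    ((lineDerivOpCLM ℂ 𝓢'(Space d, ℂ) (basisVec j)).toLinearMap ∘ₗ HDot.dist)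
    (fun u => by
      obtain ⟨g, hg⟩ := u.dist_mem.2 j
      exact ⟨g, hg.symm⟩)

theorem HDot.partialDeriv_spec (j : Fin d) (u : HDot M) :
    (u.partialDeriv j : 𝓢'(Space d, ℂ)) = ∂_{basisVec j} u.dist :=
  l2Emb_l2Rep _

/-- The inner product `∑_{j,k} ∫ G_{jk} ∂_k w \overline{∂_j u}` on `Ḣ¹` (linear in `w`). -/
@[reducible]
def HDot.core : InnerProductSpace.Core ℂ (HDot M) where
  inner u w := ∑ j, ∑ k, inner ℂ (u.partialDeriv j) (M.mulG j k (w.partialDeriv k))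
  conj_inner_symm u w := by
    simp only [map_sum, starRingEnd_apply, mulG_conj]
    exact Finset.sum_comm
  re_inner_nonneg u := by
    rw [inner_sum_eq]
    change 0 ≤ (Complex.ofReal _).re
    rw [Complex.ofReal_re]
    exact integral_nonneg fun x => add_nonneg (quad_nonneg M x _) (quad_nonneg M x _)
  add_left u v w := by
    simp only [map_add, inner_add_left, Finset.sum_add_distrib]
  smul_left u w r := by
    simp only [map_smul, inner_smul_left, Finset.mul_sum]
  definite u hu := by
    change ∑ j, ∑ k, inner ℂ (u.partialDeriv j) (M.mulG j k (u.partialDeriv k)) = 0 at hu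
    have hint : Integrable (fun x => ∑ j, ∑ k, (M.G x j k : ℂ) *
        (u.partialDeriv k x * star (u.partialDeriv j x))) :=
      integrable_finsetSum _ fun j _ => integrable_finsetSum _ fun k _ =>
        integrable_mulG M j k _ _
    have hint' := (hint.congr (Filter.Eventually.of_forall fun x =>
      quad_eq M x (fun j => u.partialDeriv j x))).re
    simp only [RCLike.re_to_complex, Complex.ofReal_re] at hint'
    rw [inner_sum_eq, Complex.ofReal_eq_zero, integral_eq_zero_iff_of_nonneg
      (fun x => add_nonneg (quad_nonneg M x _) (quad_nonneg M x _)) hint'] at hu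
    have hz : ∀ j, u.partialDeriv j = 0 := by
      intro j
      rw [Lp.eq_zero_iff_ae_eq_zero]
      filter_upwards [hu] with x hx
      have hpos : ∀ v : Fin d → ℝ, v ⬝ᵥ (M.G x).mulVec v = 0 → v = 0 := by
        intro v hv
        by_contra hne
        have := (M.G_posDef x).dotProduct_mulVec_pos hne
        simp only [star_trivial] at this
        linarith
      have h1 := quad_nonneg M x (fun j => (u.partialDeriv j x).re)
      have h2 := quad_nonneg M x (fun j => (u.partialDeriv j x).im)
      simp only [Pi.zero_apply] at hx ⊢
      have e1 := hpos _ (by linarith : (fun j => (u.partialDeriv j x).re) ⬝ᵥ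
        (M.G x).mulVec (fun j => (u.partialDeriv j x).re) = 0)
      have e2 := hpos _ (by linarith : (fun j => (u.partialDeriv j x).im) ⬝ᵥ
        (M.G x).mulVec (fun j => (u.partialDeriv j x).im) = 0)
      exact Complex.ext (congrFun e1 j) (congrFun e2 j)
    apply HDot.dist_injective
    rw [map_zero]
    refine eq_zero_of_mem_hdot u.dist_mem fun j => ?_
    rw [← HDot.partialDeriv_spec, hz j]
    exact map_zero (l2Emb d)

instance : NormedAddCommGroup (HDot M) :=
  (HDot.core (M := M)).toNormedAddCommGroup

instance : InnerProductSpace ℂ (HDot M) :=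
  InnerProductSpace.ofCore (HDot.core (M := M)).toCore

theorem HDot.inner_eq (u w : HDot M) : inner ℂ u w =
    ∑ j, ∑ k, inner ℂ (u.partialDeriv j) (M.mulG j k (w.partialDeriv k)) := rfl

end HDot

/-! ### The energy space and the wave generator -/

section Wave

variable {d : ℕ} [Fact (3 ≤ d)]

/-- The energy space `ℋ = Ḣ¹ × L²`, with `‖(u,v)‖² = ⟨G ∇u, ∇u⟩ + ‖v‖²`. -/
abbrev Energy (M : Medium d) : Type := WithLp 2 (HDot M × L2 d)

/-- The wave generator `𝒜 = [[0, I], [H₀, -i a]]` on `ℋ`, with domain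
`{(u, v) ∈ ℋ | (v, H₀ u) ∈ ℋ}`, where `H₀ u` is taken in the sense of distributions. -/
def waveGen (M : Medium d) : Energy M →ₗ.[ℂ] Energy M where
  domain :=
    { carrier := {U | l2Emb d U.snd ∈ hdot d ∧ M.H0 U.fst.dist ∈ LinearMap.range (l2Emb d)}
      zero_mem' := by
        constructor
        · simp
        · simp
      add_mem' := by
        rintro U W ⟨h1, h2⟩ ⟨h3, h4⟩
        refine ⟨?_, ?_⟩
        · simpa using add_mem h1 h3
        · simpa using add_mem h2 h4
      smul_mem' := by
        rintro c U ⟨h1, h2⟩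
        refine ⟨?_, ?_⟩
        · simpa using (hdot d).smul_mem c h1
        · simpa using (LinearMap.range (l2Emb d)).smul_mem c h2 }
  toFun :=
    { toFun := fun U => WithLp.toLp 2
        ((⟨l2Emb d U.1.snd, U.2.1⟩ : hdot d),
          l2Rep d ⟨M.H0 U.1.fst.dist, U.2.2⟩ - Complex.I • M.mulA U.1.snd)
      map_add' := by
        intro U W
        refine WithLp.ofLp_injective 2 (Prod.ext (Subtype.ext ?_) ?_)
        · exact map_add (l2Emb d) U.1.snd W.1.snd
        · have h : (⟨M.H0 (U + W).1.fst.dist, (U + W).2.2⟩ : LinearMap.range (l2Emb d))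
              = ⟨M.H0 U.1.fst.dist, U.2.2⟩ + ⟨M.H0 W.1.fst.dist, W.2.2⟩ :=
            Subtype.ext (by simp)
          simp only [h, map_add]
          simp
          abel
      map_smul' := by
        intro c U
        refine WithLp.ofLp_injective 2 (Prod.ext (Subtype.ext ?_) ?_)
        · exact map_smul (l2Emb d) c U.1.snd
        · have h : (⟨M.H0 (c • U).1.fst.dist, (c • U).2.2⟩ : LinearMap.range (l2Emb d))
              = c • ⟨M.H0 U.1.fst.dist, U.2.2⟩ :=
            Subtype.ext (by simp)
          simp only [h, map_smul]
          simp [smul_sub, smul_comm c Complex.I] }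

theorem waveGen_fst_dist (M : Medium d) (U : (waveGen M).domain) :
    (waveGen M U).fst.dist = l2Emb d U.1.snd := rfl

theorem waveGen_snd (M : Medium d) (U : (waveGen M).domain) :
    l2Emb d (waveGen M U).snd = M.H0 U.1.fst.dist - l2Emb d (Complex.I • M.mulA U.1.snd) := by
  change l2Emb d (l2Rep d _ - Complex.I • M.mulA U.1.snd) = _
  rw [map_sub, l2Emb_l2Rep]

/-- The domain `𝒟(𝒜)`, which carries the norm `‖(u,v)‖_ℋ + ‖H₀ u‖ + ‖H₀^{1/2} v‖`. -/
def DomA (M : Medium d) : Type := (waveGen M).domain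

instance (M : Medium d) : AddCommGroup (DomA M) := inferInstanceAs (AddCommGroup (waveGen M).domain)

instance (M : Medium d) : Module ℂ (DomA M) := inferInstanceAs (Module ℂ (waveGen M).domain)

variable {M : Medium d}

/-- The inclusion of `𝒟(𝒜)` in `ℋ`. -/
def DomA.incl : DomA M →ₗ[ℂ] Energy M := (waveGen M).domain.subtype

/-- The wave generator, as a map on `𝒟(𝒜)`. -/
def DomA.gen : DomA M →ₗ[ℂ] Energy M := (waveGen M).toFun

/-- The function `H₀ u ∈ L²`, for `(u, v) ∈ 𝒟(𝒜)`. -/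
def DomA.h0 : DomA M →ₗ[ℂ] L2 d :=
  l2Rep d ∘ₗ LinearMap.codRestrict (LinearMap.range (l2Emb d))
    (M.H0.toLinearMap ∘ₗ HDot.dist ∘ₗ
      (WithLp.fstₗ 2 ℂ (HDot M) (L2 d)) ∘ₗ DomA.incl) (fun U => U.2.2)

/-- The component `v`, as an element of `Ḣ¹`, for `(u, v) ∈ 𝒟(𝒜)`. -/
def DomA.vHDot : DomA M →ₗ[ℂ] HDot M :=
  (LinearMap.codRestrict (hdot d)
    (l2Emb d ∘ₗ (WithLp.sndₗ 2 ℂ (HDot M) (L2 d)) ∘ₗ DomA.incl) (fun U => U.2.1) :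
      DomA M →ₗ[ℂ] hdot d)

theorem DomA.h0_spec (U : DomA M) : l2Emb d U.h0 = M.H0 U.incl.fst.dist := l2Emb_l2Rep _

theorem DomA.vHDot_spec (U : DomA M) : U.vHDot.dist = l2Emb d U.incl.snd := rfl

/-- The map `(u, v) ↦ ((u, v), H₀ u, v)` which gives the norm of `𝒟(𝒜)`. -/
def DomA.graphEmb : DomA M →ₗ[ℂ] WithLp 1 (Energy M × WithLp 1 (L2 d × HDot M)) :=
  (WithLp.linearEquiv 1 ℂ (Energy M × WithLp 1 (L2 d × HDot M))).symm.toLinearMap ∘ₗ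
    DomA.incl.prod ((WithLp.linearEquiv 1 ℂ (L2 d × HDot M)).symm.toLinearMap ∘ₗ
      DomA.h0.prod DomA.vHDot)

theorem DomA.graphEmb_injective : Function.Injective (DomA.graphEmb : DomA M →ₗ[ℂ] _) := by
  intro U W h
  exact Subtype.ext (congrArg (fun p => p.fst) h)

instance : NormedAddCommGroup (DomA M) :=
  NormedAddCommGroup.induced _ _ (DomA.graphEmb (M := M)) DomA.graphEmb_injective

instance : NormedSpace ℂ (DomA M) := NormedSpace.induced ℂ _ _ (DomA.graphEmb (M := M))

theorem DomA.norm_eq (U : DomA M) : ‖U‖ = ‖U.incl‖ + (‖U.h0‖ + ‖U.vHDot‖) := by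
  change ‖U.graphEmb‖ = _
  rw [WithLp.prod_norm_eq_of_L1, WithLp.prod_norm_eq_of_L1]
  rfl

/-! ### The matrix of resolvents -/

/-- A pair of Schwartz functions, as an element of `ℋ`. -/
def schwartzPair (M : Medium d) (f g : 𝓢(Space d, ℂ)) : Energy M :=
  WithLp.toLp 2 ((⟨(f : 𝓢'(Space d, ℂ)), schwartz_mem_hdot f⟩ : hdot d), g.toLp 2)

/-- `W ∈ 𝒟(𝒜)` is the product of the matrix
`[[R(z)(i a + z), R(z)], [I + R(z)(z i a + z²), z R(z)]]` and of the column `(f, g)`. -/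
def Medium.IsMatrixProduct (M : Medium d) (z : ℂ) (f g : 𝓢(Space d, ℂ)) (W : DomA M) : Prop :=
  let f' : L2 d := f.toLp 2
  let g' : L2 d := g.toLp 2
  W.incl.fst.dist = l2Emb d (M.R z (Complex.I • M.mulA f' + z • f') + M.R z g') ∧
  W.incl.snd = f' + M.R z ((z * Complex.I) • M.mulA f' + z ^ 2 • f') + z • M.R z g'

/-- The graph, in `ℋ × 𝒟(𝒜)`, of the operator which the matrix defines on `𝓢 × 𝓢`. -/
def Medium.matrixGraph (M : Medium d) (z : ℂ) : Set (Energy M × DomA M) :=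
  {p | ∃ f g : 𝓢(Space d, ℂ), p.1 = schwartzPair M f g ∧ M.IsMatrixProduct z f g p.2}

end Wave

/-! ### Dissipative operators -/

section Dissipative

variable {K : Type*} [NormedAddCommGroup K] [InnerProductSpace ℂ K]

/-- `T` is dissipative: `Im ⟨T φ, φ⟩ ≤ 0` on its domain. (The inner product of Mathlib is
antilinear in its first argument.) -/
def IsDissipative (T : K →ₗ.[ℂ] K) : Prop :=
  ∀ φ : T.domain, (inner ℂ (φ : K) (T φ)).im ≤ 0

/-- `T` is maximal dissipative: it is dissipative and is its only dissipative extension. -/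
def IsMaximalDissipative (T : K →ₗ.[ℂ] K) : Prop :=
  IsDissipative T ∧ ∀ S : K →ₗ.[ℂ] K, IsDissipative S → T ≤ S → S = T

end Dissipative

end DampedWave

end

open DampedWave

/-! Two ingredients give everything: the bounded inverse `R z` of the stationary operator on `L²`,
and Green's formula between `Ḣ¹` and `L²`.

Function spaces. The Sobolev inequality passes from compactly supported functions to Schwartz
functions by a dilated cutoff. Hence an `L²`-limit of Schwartz gradients is the gradient of an
element of `Ḣ¹`. Conversely, the part of an `L²` gradient orthogonal to all Schwartz gradients has
harmonic components in `L²`, so it vanishes (`exists_schwartz_grad_tendsto`). Since `G` is uniformly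
elliptic (`Medium.exists_elliptic`), the norm of `Ḣ¹` is equivalent to `‖∇u‖`. Completeness of `ℋ`
and density of `𝓢 × 𝓢` follow.

Stationary operator. Let `J = (1 - κΔ)⁻¹` with `κ = (2π)⁻²`, an isomorphism from `L²` to `H²`, and
let `P = (H₀ - iza - z²) J` on `L²`. For `f = u - κΔu`, testing `P f` against `u` controls `u` and
`∇u`, and testing it against `-Δu` controls the second derivatives up to a commutator with `∇G`. For
large `ν` the combination `(1 + νJ) f` makes the form coercive, so `(1 + νJ)* P` is invertible by
Lax–Milgram. As `1 + νJ` is invertible too, so is `P` (`Medium.isUnit_stationary`), and `R z = J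
P⁻¹`. This needs neither elliptic regularity nor self-adjointness of `H₀`.

Generator. Green's formula `HDot.inner_eq_inner_H0` gives `Im ⟨𝒜U, U⟩ = -⟨a v, v⟩ ≤ 0` for `U = (u,
v)`, whence `Im z ‖U‖ ≤ ‖(𝒜 - z)U‖`. Eliminating `v` from `(𝒜 - z)(u, v) = (f, g)` leaves one
stationary equation for `u`, whose solution by `R z` is exactly the matrix
(`exists_isMatrixProduct`). So the range of `𝒜 - z` is dense. As `𝒜` is closed and `𝒜 - z` is
bounded below, the range is all of `ℋ`. Maximality follows from surjectivity at `z = i`. -/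

noncomputable section
namespace DampedWave

/-! ### The Sobolev inequality for Schwartz functions -/

section SobolevInequality

open Filter Topology
open scoped NNReal

variable {d : ℕ}

/-- A cutoff function, equal to `1` on the unit ball. -/
def cutoffBump (d : ℕ) : ContDiffBump (0 : Space d) := ⟨1, 2, one_pos, one_lt_two⟩

/-- The left side vanishes for `‖x‖ ≤ n + 1` and is at most `1 ≤ ‖x‖ / (n + 1)` beyond. The
quadratic weight buys an explicit rate and is harmless against Schwartz decay. -/
theorem norm_one_sub_cutoff_le (x : Space d) (n : ℕ) :
    ‖1 - cutoffBump d ((n + 1 : ℝ)⁻¹ • x)‖ ≤ (n + 1 : ℝ)⁻¹ * (1 + ‖x‖ ^ 2) := by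
  have hn : (0 : ℝ) < n + 1 := by positivity
  by_cases h : ‖(n + 1 : ℝ)⁻¹ • x‖ ≤ 1
  · rw [(cutoffBump d).one_of_mem_closedBall (by simpa [cutoffBump] using h)]
    simp only [sub_self, norm_zero]
    positivity
  · rw [norm_smul, Real.norm_eq_abs, abs_of_pos (inv_pos.mpr hn)] at h
    have h1 : ‖1 - cutoffBump d ((n + 1 : ℝ)⁻¹ • x)‖ ≤ 1 := by
      rw [Real.norm_eq_abs, abs_le]
      constructor <;> linarith [(cutoffBump d).nonneg' ((n + 1 : ℝ)⁻¹ • x),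
        (cutoffBump d).le_one (x := (n + 1 : ℝ)⁻¹ • x)]
    have h2 : (n + 1 : ℝ)⁻¹ * ‖x‖ ≤ (n + 1 : ℝ)⁻¹ * (1 + ‖x‖ ^ 2) := by
      gcongr
      nlinarith [sq_nonneg (‖x‖ - 1)]
    linarith

theorem exists_fderiv_cutoff_le (d : ℕ) : ∃ B : ℝ, 0 ≤ B ∧ ∀ x : Space d,
    ‖fderiv ℝ (cutoffBump d) x‖ ≤ B := by
  have hc : ContDiff ℝ 1 (cutoffBump d) := (cutoffBump d).contDiff
  obtain ⟨B, hB⟩ := (hc.continuous_fderiv one_ne_zero).bounded_above_of_compact_support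
    ((cutoffBump d).hasCompactSupport.fderiv ℝ)
  exact ⟨B, (norm_nonneg _).trans (hB 0), hB⟩

theorem norm_clm_le_sum_basisVec (A : Space d →L[ℝ] ℂ) : ‖A‖ ≤ ∑ j, ‖A (basisVec j)‖ := by
  refine A.opNorm_le_bound (by positivity) fun v => ?_
  have hb : ∑ j, v j • (basisVec j : Space d) = v := by
    simpa using (EuclideanSpace.basisFun (Fin d) ℝ).sum_repr v
  conv_lhs => rw [← hb, map_sum]
  refine (norm_sum_le _ _).trans ?_
  rw [Finset.sum_mul]
  refine Finset.sum_le_sum fun j _ => ?_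
  rw [map_smul, norm_smul, mul_comm]
  exact mul_le_mul_of_nonneg_left (PiLp.norm_apply_le v j) (norm_nonneg _)

theorem eLpNorm_fderiv_cutoff_mul_le {B : ℝ} (hB0 : 0 ≤ B)
    (hB : ∀ x : Space d, ‖fderiv ℝ (cutoffBump d) x‖ ≤ B) (φ : 𝓢(Space d, ℂ)) (n : ℕ) :
    eLpNorm (fderiv ℝ fun x => cutoffBump d ((n + 1 : ℝ)⁻¹ • x) • φ x) 2 volume ≤
      eLpNorm (fderiv ℝ φ) 2 volume +
        ENNReal.ofReal ((n + 1 : ℝ)⁻¹ * B) * eLpNorm φ 2 volume := by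
  have hn : (0 : ℝ) < n + 1 := by positivity
  have hfd : ∀ x, HasFDerivAt (fun x => cutoffBump d ((n + 1 : ℝ)⁻¹ • x) • φ x)
      (cutoffBump d ((n + 1 : ℝ)⁻¹ • x) • fderiv ℝ φ x +
        ((fderiv ℝ (cutoffBump d) ((n + 1 : ℝ)⁻¹ • x)).comp
          ((n + 1 : ℝ)⁻¹ • ContinuousLinearMap.id ℝ _)).smulRight (φ x)) x := by
    intro x
    have hc : ContDiff ℝ 1 (cutoffBump d) := (cutoffBump d).contDiff
    have h1 := ((hc.differentiable one_ne_zero) ((n + 1 : ℝ)⁻¹ • x)).hasFDerivAt.comp x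
      ((hasFDerivAt_id x).const_smul (n + 1 : ℝ)⁻¹)
    exact h1.smul (φ.hasFDerivAt x)
  have h1 : eLpNorm (fderiv ℝ fun x => cutoffBump d ((n + 1 : ℝ)⁻¹ • x) • φ x) 2 volume ≤
      eLpNorm (fun x => ‖fderiv ℝ φ x‖ + (n + 1 : ℝ)⁻¹ * B * ‖φ x‖) 2 volume := by
    refine eLpNorm_mono_real fun x => ?_
    rw [(hfd x).fderiv]
    refine (norm_add_le _ _).trans (add_le_add ?_ ?_)
    · rw [norm_smul, Real.norm_eq_abs, abs_of_nonneg ((cutoffBump d).nonneg' _)]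
      exact mul_le_of_le_one_left (norm_nonneg _) (cutoffBump d).le_one
    · rw [ContinuousLinearMap.norm_smulRight_apply, ContinuousLinearMap.comp_smul,
        ContinuousLinearMap.comp_id, norm_smul, Real.norm_eq_abs, abs_of_pos (inv_pos.mpr hn)]
      gcongr
      exact hB _
  refine h1.trans ((eLpNorm_add_le ?_ ?_ one_le_two).trans (add_le_add ?_ ?_))
  · exact (((φ.smooth ⊤).continuous_fderiv (by simp)).norm).aestronglyMeasurable
  · exact (continuous_const.mul φ.continuous.norm).aestronglyMeasurable
  · rw [eLpNorm_norm]
  · refine eLpNorm_le_mul_eLpNorm_of_ae_le_mul (Eventually.of_forall fun x => ?_) 2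
    rw [norm_mul, norm_norm, Real.norm_eq_abs, abs_of_nonneg (by positivity)]

/-- `K` is the `L^p` norm of `(1 + ‖x‖²) φ`, which is again a Schwartz function. -/
theorem eLpNorm_sub_cutoff_mul_le (φ : 𝓢(Space d, ℂ)) (p : ℝ≥0∞) :
    ∃ K : ℝ≥0∞, K ≠ ⊤ ∧ ∀ n : ℕ,
      eLpNorm (fun x => φ x - cutoffBump d ((n + 1 : ℝ)⁻¹ • x) • φ x) p volume ≤
        ENNReal.ofReal ((n + 1 : ℝ)⁻¹) * K := by
  have hg : (fun x : Space d => (1 + ‖x‖ ^ 2 : ℝ)).HasTemperateGrowth := by fun_prop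
  refine ⟨eLpNorm (SchwartzMap.smulLeftCLM ℂ (fun x : Space d => (1 + ‖x‖ ^ 2 : ℝ)) φ) p volume,
    (SchwartzMap.memLp _ p volume).eLpNorm_ne_top, fun n => ?_⟩
  refine eLpNorm_le_mul_eLpNorm_of_ae_le_mul (Eventually.of_forall fun x => ?_) p
  rw [SchwartzMap.smulLeftCLM_apply_apply hg, norm_smul, ← mul_assoc, Real.norm_of_nonneg (by positivity)]
  have : φ x - cutoffBump d ((n + 1 : ℝ)⁻¹ • x) • φ x
      = (1 - cutoffBump d ((n + 1 : ℝ)⁻¹ • x)) • φ x := by rw [sub_smul, one_smul]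
  rw [this, norm_smul]
  exact mul_le_mul_of_nonneg_right (norm_one_sub_cutoff_le x n) (norm_nonneg _)

/-- The inequality is known for compactly supported `C¹` functions. It is applied to `χ(x / (n + 1))
φ`; both errors, from truncating `φ` and from differentiating the cutoff, are `O(1 / n)`. -/
theorem exists_eLpNorm_sobolev_le (d : ℕ) [hd : Fact (3 ≤ d)] : ∃ C : ℝ≥0, ∀ φ : 𝓢(Space d, ℂ),
    eLpNorm φ (sobolevExp d) volume ≤ C * eLpNorm (fderiv ℝ φ) 2 volume := by
  have h3 : (3 : ℝ) ≤ d := by exact_mod_cast hd.out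
  refine ⟨SNormLESNormFDerivOfEqConst ℂ (volume : Measure (Space d)) ((2 : ℝ≥0) : ℝ), fun φ => ?_⟩
  set C := SNormLESNormFDerivOfEqConst ℂ (volume : Measure (Space d)) ((2 : ℝ≥0) : ℝ)
  obtain ⟨B, hB0, hB⟩ := exists_fderiv_cutoff_le d
  obtain ⟨K, hK, hsub⟩ := eLpNorm_sub_cutoff_mul_le φ (sobolevExp d)
  have hbound : ∀ n : ℕ, eLpNorm φ (sobolevExp d) volume ≤
      ENNReal.ofReal ((n + 1 : ℝ)⁻¹) * K + C * (eLpNorm (fderiv ℝ φ) 2 volume +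
        ENNReal.ofReal ((n + 1 : ℝ)⁻¹ * B) * eLpNorm φ 2 volume) := by
    intro n
    have hsm : ContDiff ℝ 1 (fun x => cutoffBump d ((n + 1 : ℝ)⁻¹ • x) • φ x) :=
      ((cutoffBump d).contDiff.comp (contDiff_const_smul _)).smul
        ((φ.smooth ⊤).of_le (by simp))
    have hcs : HasCompactSupport (fun x => cutoffBump d ((n + 1 : ℝ)⁻¹ • x) • φ x) := by
      refine HasCompactSupport.smul_right (f := fun x => cutoffBump d ((n + 1 : ℝ)⁻¹ • x)) ?_
      exact (cutoffBump d).hasCompactSupport.comp_smul (by positivity)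
    have hgns := eLpNorm_le_eLpNorm_fderiv_of_eq (volume : Measure (Space d)) hsm hcs
      (p := 2) (p' := Real.toNNReal (2 * d / (d - 2))) one_le_two (by have := hd.out; rw [finrank_euclideanSpace_fin]; omega) (by
        rw [Real.coe_toNNReal _ (div_nonneg (by positivity) (by linarith)),
          finrank_euclideanSpace_fin]
        have : (d : ℝ) - 2 ≠ 0 := by linarith
        push_cast
        field_simp)
    have h1 : (φ : Space d → ℂ) =
        (fun x => φ x - cutoffBump d ((n + 1 : ℝ)⁻¹ • x) • φ x) +
          fun x => cutoffBump d ((n + 1 : ℝ)⁻¹ • x) • φ x := by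
      ext x; simp
    calc eLpNorm φ (sobolevExp d) volume
        ≤ eLpNorm (fun x => φ x - cutoffBump d ((n + 1 : ℝ)⁻¹ • x) • φ x) (sobolevExp d) volume
          + eLpNorm (fun x => cutoffBump d ((n + 1 : ℝ)⁻¹ • x) • φ x) (sobolevExp d) volume := by
          conv_lhs => rw [h1]
          exact eLpNorm_add_le (φ.continuous.sub hsm.continuous).aestronglyMeasurable
            hsm.continuous.aestronglyMeasurable (one_le_sobolevExp d).out
      _ ≤ _ := by
          refine add_le_add (hsub n) (hgns.trans ?_)
          gcongr
          exact eLpNorm_fderiv_cutoff_mul_le hB0 hB φ n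
  have h0 : Tendsto (fun n : ℕ => ENNReal.ofReal ((n + 1 : ℝ)⁻¹)) atTop (𝓝 0) := by
    rw [← ENNReal.ofReal_zero]
    refine ENNReal.tendsto_ofReal ?_
    simpa only [one_div] using tendsto_one_div_add_atTop_nhds_zero_nat (𝕜 := ℝ)
  have h0' : Tendsto (fun n : ℕ => ENNReal.ofReal ((n + 1 : ℝ)⁻¹ * B)) atTop (𝓝 0) := by
    rw [← ENNReal.ofReal_zero]
    refine ENNReal.tendsto_ofReal ?_
    simpa [one_div] using (tendsto_one_div_add_atTop_nhds_zero_nat (𝕜 := ℝ)).mul_const B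
  have hlim : Tendsto (fun n : ℕ => ENNReal.ofReal ((n + 1 : ℝ)⁻¹) * K +
      C * (eLpNorm (fderiv ℝ φ) 2 volume +
        ENNReal.ofReal ((n + 1 : ℝ)⁻¹ * B) * eLpNorm φ 2 volume)) atTop
      (𝓝 (0 * K + C * (eLpNorm (fderiv ℝ φ) 2 volume + 0 * eLpNorm φ 2 volume))) := by
    refine (ENNReal.Tendsto.mul_const h0 (Or.inr hK)).add
      (ENNReal.Tendsto.const_mul (tendsto_const_nhds.add
        (ENNReal.Tendsto.mul_const h0' (Or.inr (φ.memLp 2 volume).eLpNorm_ne_top))) (Or.inr (by simp)))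
  have := ge_of_tendsto' hlim hbound
  simpa using this

/-- The Gagliardo-Nirenberg-Sobolev inequality on Schwartz functions. -/
theorem exists_norm_sobolev_le (d : ℕ) [Fact (3 ≤ d)] : ∃ C : ℝ, 0 ≤ C ∧ ∀ φ : 𝓢(Space d, ℂ),
    ‖φ.toLp (sobolevExp d)‖ ≤ C * ∑ j : Fin d, ‖(∂_{basisVec j} φ).toLp 2‖ := by
  obtain ⟨C, hC⟩ := exists_eLpNorm_sobolev_le d
  refine ⟨C, C.2, fun φ => ?_⟩
  have h1 : eLpNorm (fderiv ℝ φ) 2 volume ≤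
      ∑ j : Fin d, eLpNorm (∂_{basisVec j} φ : 𝓢(Space d, ℂ)) 2 volume := by
    have h2 : eLpNorm (fderiv ℝ φ) 2 volume ≤
        eLpNorm (∑ j : Fin d, fun x => ‖(∂_{basisVec j} φ : 𝓢(Space d, ℂ)) x‖) 2 volume := by
      refine eLpNorm_mono_real fun x => ?_
      simp only [Finset.sum_apply, SchwartzMap.lineDerivOp_apply_eq_fderiv]
      exact norm_clm_le_sum_basisVec _
    refine h2.trans ((eLpNorm_sum_le (fun j _ => ?_) one_le_two).trans (le_of_eq ?_))
    · exact (∂_{basisVec j} φ).continuous.norm.aestronglyMeasurable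
    · simp only [eLpNorm_norm]
  have hfin : ∀ j : Fin d, eLpNorm (∂_{basisVec j} φ : 𝓢(Space d, ℂ)) 2 volume ≠ ⊤ :=
    fun j => ((∂_{basisVec j} φ : 𝓢(Space d, ℂ)).memLp 2 volume).eLpNorm_ne_top
  simp only [SchwartzMap.norm_toLp]
  rw [← ENNReal.toReal_sum fun j _ => hfin j, ← ENNReal.coe_toReal, ← ENNReal.toReal_mul]
  refine ENNReal.toReal_mono ?_ ((hC φ).trans (by gcongr))
  exact ENNReal.mul_ne_top ENNReal.coe_ne_top (ENNReal.sum_ne_top.mpr fun j _ => hfin j)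

end SobolevInequality

/-! ### Conjugation, Fourier multipliers and line derivatives -/

section Tools

open Filter Topology
open scoped FourierTransform Laplacian

variable {d : ℕ}

/-- The complex conjugate of a Schwartz function. -/
def conjS (φ : 𝓢(Space d, ℂ)) : 𝓢(Space d, ℂ) :=
  SchwartzMap.postcompCLM (𝕜 := ℝ) (Complex.conjCLE : ℂ →L[ℝ] ℂ) φ

theorem conjS_apply (φ : 𝓢(Space d, ℂ)) (x : Space d) : conjS φ x = star (φ x) := rfl

theorem conjS_conjS (φ : 𝓢(Space d, ℂ)) : conjS (conjS φ) = φ := by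
  ext x
  simp [conjS_apply]

theorem lineDerivOp_conjS (m : Space d) (φ : 𝓢(Space d, ℂ)) :
    ∂_{m} (conjS φ) = conjS (∂_{m} φ) := by
  ext x
  rw [conjS_apply, SchwartzMap.lineDerivOp_apply_eq_fderiv,
    SchwartzMap.lineDerivOp_apply_eq_fderiv]
  have h : HasFDerivAt (conjS φ) ((Complex.conjCLE : ℂ →L[ℝ] ℂ).comp (fderiv ℝ φ x)) x :=
    (Complex.conjCLE : ℂ →L[ℝ] ℂ).hasFDerivAt.comp x (φ.hasFDerivAt x)
  rw [h.fderiv]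
  rfl

/-- The pairing of distributions is bilinear, hence the conjugate. This is the bridge by which
orthogonality relations become distributional equations. -/
theorem inner_schwartz_eq (φ : 𝓢(Space d, ℂ)) (h : L2 d) :
    inner ℂ (φ.toLp 2 : L2 d) h = l2Emb d h (conjS φ) := by
  rw [L2.inner_def]
  refine Eq.trans ?_ (Lp.toTemperedDistribution_apply h (conjS φ)).symm
  refine integral_congr_ae ?_
  filter_upwards [φ.coeFn_toLp 2 volume] with x hx
  rw [hx, RCLike.inner_apply, conjS_apply, starRingEnd_apply, smul_eq_mul, mul_comm]

theorem l2Emb_toLp (φ : 𝓢(Space d, ℂ)) : l2Emb d (φ.toLp 2) = (φ : 𝓢'(Space d, ℂ)) :=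
  Lp.toTemperedDistribution_toLp_eq φ

theorem l2Emb_apply (h : L2 d) (ψ : 𝓢(Space d, ℂ)) : l2Emb d h ψ = ∫ x, ψ x * h x :=
  Lp.toTemperedDistribution_apply h ψ

theorem continuous_l2Emb : Continuous (l2Emb d) :=
  (Lp.toTemperedDistributionCLM ℂ (volume : Measure (Space d)) 2).continuous

/-- On the Fourier side `m · 𝓕 f = 0`, so `𝓕 f` is supported in the null set `{0}`. With `m = ‖x‖²`
it says that a harmonic `L²` function is zero. -/
theorem eq_zero_of_fourierMultiplier_eq_zero [NeZero d] {m : Space d → ℂ}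
    (hm : m.HasTemperateGrowth) (hm0 : ∀ x, x ≠ 0 → m x ≠ 0) (f : L2 d)
    (h : TemperedDistribution.fourierMultiplierCLM ℂ m (l2Emb d f) = 0) : f = 0 := by
  have h1 : TemperedDistribution.smulLeftCLM ℂ m (l2Emb d (𝓕 f)) = 0 := by
    have h2 := congrArg (fun T : 𝓢'(Space d, ℂ) => 𝓕 T) h
    simp only [TemperedDistribution.fourierMultiplierCLM_apply,
      FourierTransform.fourier_fourierInv_eq] at h2
    have h3 : (𝓕 (l2Emb d f) : 𝓢'(Space d, ℂ)) = l2Emb d (𝓕 f) :=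
      Lp.fourier_toTemperedDistribution_eq f
    rw [h3] at h2
    rw [h2]
    exact map_zero (FourierTransform.fourierCLM ℂ 𝓢'(Space d, ℂ))
  have h4 : (fun x => m x * (𝓕 f : L2 d) x) =ᵐ[volume] 0 := by
    refine ae_eq_zero_of_integral_contDiff_smul_eq_zero ?_ fun g hg hgc => ?_
    · have := (((Lp.memLp (𝓕 f : L2 d)).locallyIntegrable one_le_two).locallyIntegrableOn
        Set.univ).continuousOn_mul hm.1.continuous.continuousOn
        isOpen_univ.isLocallyClosed
      exact locallyIntegrableOn_univ.mp this
    · have hg₁ : HasCompactSupport (Complex.ofRealCLM ∘ g) := hgc.comp_left rfl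
      have hg₂ : ContDiff ℝ ∞ (Complex.ofRealCLM ∘ g) := by fun_prop
      have h5 := congrArg (fun T : 𝓢'(Space d, ℂ) => T (hg₁.toSchwartzMap hg₂)) h1
      simp only [TemperedDistribution.smulLeftCLM_apply_apply, l2Emb_apply] at h5
      refine Eq.trans (integral_congr_ae (Eventually.of_forall fun x => ?_)) h5
      simp only [SchwartzMap.smulLeftCLM_apply_apply hm]
      change (g x : ℝ) • (m x * _) = m x * (g x : ℂ) * _
      rw [Complex.real_smul]
      ring
  have h6 : (𝓕 f : L2 d) = 0 := by
    rw [Lp.eq_zero_iff_ae_eq_zero]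
    have hne : ∀ᵐ x : Space d, x ≠ 0 := by
      simp [ae_iff]
    filter_upwards [h4, hne] with x hx hx0
    exact (mul_eq_zero.mp hx).resolve_left (hm0 x hx0)
  rw [← norm_eq_zero, ← Lp.norm_fourier_eq, h6, norm_zero]

theorem lineDerivOp_comm_fourierMultiplier {m : Space d → ℂ} (hm : m.HasTemperateGrowth)
    (v : Space d) (T : 𝓢'(Space d, ℂ)) :
    TemperedDistribution.fourierMultiplierCLM ℂ m (∂_{v} T) =
      ∂_{v} (TemperedDistribution.fourierMultiplierCLM ℂ m T) := by
  rw [TemperedDistribution.lineDeriv_eq_fourierMultiplierCLM,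
    TemperedDistribution.lineDeriv_eq_fourierMultiplierCLM, map_smul,
    TemperedDistribution.fourierMultiplierCLM_fourierMultiplierCLM_apply (by fun_prop) hm,
    TemperedDistribution.fourierMultiplierCLM_fourierMultiplierCLM_apply hm (by fun_prop),
    mul_comm m]

theorem lineDerivOp_comm (v w : Space d) (T : 𝓢'(Space d, ℂ)) :
    ∂_{v} (∂_{w} T) = ∂_{w} (∂_{v} T) := by
  conv_lhs => rw [TemperedDistribution.lineDeriv_eq_fourierMultiplierCLM w T, lineDerivOp_smul,
    ← lineDerivOp_comm_fourierMultiplier (by fun_prop)]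
  rw [TemperedDistribution.lineDeriv_eq_fourierMultiplierCLM w (∂_{v} T)]

theorem laplacian_eq_sum_basisVec (T : 𝓢'(Space d, ℂ)) :
    Δ T = ∑ j : Fin d, ∂_{basisVec j} (∂_{basisVec j} T) := by
  rw [TemperedDistribution.laplacian_eq_sum (EuclideanSpace.basisFun (Fin d) ℝ)]
  simp [EuclideanSpace.basisFun_apply]

end Tools

/-! ### Gradients of Schwartz functions -/

section Gradient

open Filter Topology
open scoped Laplacian Real

variable {d : ℕ}

/-- The Hilbert space of square integrable vector fields. -/
abbrev VectorL2 (d : ℕ) : Type := PiLp 2 (fun _ : Fin d => L2 d)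

/-- A Schwartz function as an element of `L²`. -/
def schwartzL2 (d : ℕ) : 𝓢(Space d, ℂ) →ₗ[ℂ] L2 d :=
  (SchwartzMap.toLpCLM ℂ ℂ 2 (volume : Measure (Space d))).toLinearMap

theorem schwartzL2_dense (v : L2 d) :
    ∃ φ : ℕ → 𝓢(Space d, ℂ), Tendsto (fun n => ((φ n).toLp 2 : L2 d)) atTop (𝓝 v) := by
  obtain ⟨y, hy, hlim⟩ := mem_closure_iff_seq_limit.mp
    ((SchwartzMap.denseRange_toLpCLM (F := ℂ) (p := 2) (μ := (volume : Measure (Space d)))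
      (by simp)) v)
  choose φ hφ using hy
  have hy' : y = fun n => ((φ n).toLp 2 : L2 d) := funext fun n => (hφ n).symm
  exact ⟨φ, hy' ▸ hlim⟩

/-- The gradient of a Schwartz function, in `L²`. -/
def schwartzGrad (d : ℕ) : 𝓢(Space d, ℂ) →ₗ[ℂ] VectorL2 d :=
  (WithLp.linearEquiv 2 ℂ (Fin d → L2 d)).symm.toLinearMap ∘ₗ
    LinearMap.pi fun j => schwartzL2 d ∘ₗ (lineDerivOpCLM ℂ 𝓢(Space d, ℂ) (basisVec j)).toLinearMap

theorem schwartzGrad_apply (φ : 𝓢(Space d, ℂ)) (j : Fin d) :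
    schwartzGrad d φ j = (∂_{basisVec j} φ).toLp 2 := rfl

/-- Integration by parts. A gradient orthogonal to every Schwartz gradient is thus the gradient of a
harmonic distribution. -/
theorem inner_schwartzGrad (φ : 𝓢(Space d, ℂ)) (g : VectorL2 d) (T : 𝓢'(Space d, ℂ))
    (hT : ∀ j, ∂_{basisVec j} T = l2Emb d (g j)) :
    inner ℂ (schwartzGrad d φ) g = -(Δ T) (conjS φ) := by
  rw [PiLp.inner_apply, laplacian_eq_sum_basisVec]
  simp only [schwartzGrad_apply, inner_schwartz_eq, ← lineDerivOp_conjS, hT]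
  have h : ∀ j : Fin d, l2Emb d (g j) (∂_{basisVec j} (conjS φ)) =
      -(∂_{basisVec j} (l2Emb d (g j))) (conjS φ) := by
    intro j
    rw [TemperedDistribution.lineDerivOp_apply_apply, map_neg, neg_neg]
  simp only [h, Finset.sum_neg_distrib]
  congr 1
  exact (sum_apply _ _ _).symm

/-- Both convergences hold in the sense of distributions, where differentiation is continuous and
limits are unique. -/
theorem lineDeriv_limit {p : ℝ≥0∞} [Fact (1 ≤ p)] {φ : ℕ → 𝓢(Space d, ℂ)}
    {f : Lp ℂ p (volume : Measure (Space d))} {g : VectorL2 d}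
    (hf : Tendsto (fun n => (φ n).toLp p) atTop (𝓝 f))
    (hg : Tendsto (fun n => schwartzGrad d (φ n)) atTop (𝓝 g)) (j : Fin d) :
    ∂_{basisVec j} (f : 𝓢'(Space d, ℂ)) = l2Emb d (g j) := by
  have h1 : Tendsto (fun n => ∂_{basisVec j} (φ n : 𝓢'(Space d, ℂ))) atTop
      (𝓝 (∂_{basisVec j} (f : 𝓢'(Space d, ℂ)))) := by
    have := ((lineDerivOpCLM ℂ 𝓢'(Space d, ℂ) (basisVec j)).continuous.comp
      (Lp.toTemperedDistributionCLM ℂ (volume : Measure (Space d)) p).continuous).tendsto f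
    refine (this.comp hf).congr fun n => ?_
    change ∂_{basisVec j} (((φ n).toLp p : Lp ℂ p volume) : 𝓢'(Space d, ℂ)) = _
    rw [Lp.toTemperedDistribution_toLp_eq]
  have h2 : Tendsto (fun n => ∂_{basisVec j} (φ n : 𝓢'(Space d, ℂ))) atTop
      (𝓝 (l2Emb d (g j))) := by
    have h3 : Tendsto (fun n => schwartzGrad d (φ n) j) atTop (𝓝 (g j)) :=
      ((PiLp.continuous_apply 2 _ j).tendsto g).comp hg
    refine ((continuous_l2Emb.tendsto (g j)).comp h3).congr fun n => ?_
    change l2Emb d (schwartzGrad d (φ n) j) = _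
    rw [schwartzGrad_apply, l2Emb_toLp, lineDerivOp_toTemperedDistributionCLM_eq]
  exact tendsto_nhds_unique h1 h2

theorem exists_norm_sobolev_le_grad (d : ℕ) [Fact (3 ≤ d)] : ∃ C : ℝ, 0 ≤ C ∧
    ∀ φ : 𝓢(Space d, ℂ), ‖φ.toLp (sobolevExp d)‖ ≤ C * ‖schwartzGrad d φ‖ := by
  obtain ⟨C, hC0, hC⟩ := exists_norm_sobolev_le d
  refine ⟨C * d, by positivity, fun φ => (hC φ).trans ?_⟩
  rw [mul_assoc]
  refine mul_le_mul_of_nonneg_left ?_ hC0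
  refine (Finset.sum_le_card_nsmul _ _ ‖schwartzGrad d φ‖ fun j _ => ?_).trans (by simp)
  exact PiLp.norm_apply_le (schwartzGrad d φ) j

/-- A limit of gradients of Schwartz functions is the gradient of an element of `Ḣ¹`. -/
theorem exists_sobolev_limit [Fact (3 ≤ d)] {C : ℝ}
    (hC : ∀ φ : 𝓢(Space d, ℂ), ‖φ.toLp (sobolevExp d)‖ ≤ C * ‖schwartzGrad d φ‖)
    {φ : ℕ → 𝓢(Space d, ℂ)} {g : VectorL2 d}
    (hg : Tendsto (fun n => schwartzGrad d (φ n)) atTop (𝓝 g)) :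
    ∃ f : Lp ℂ (sobolevExp d) (volume : Measure (Space d)),
      Tendsto (fun n => (φ n).toLp (sobolevExp d)) atTop (𝓝 f) ∧ ‖f‖ ≤ C * ‖g‖ := by
  have hcau : CauchySeq (fun n => (φ n).toLp (sobolevExp d)) := by
    have h1 := hg.cauchySeq
    rw [cauchySeq_iff_tendsto_dist_atTop_0] at h1 ⊢
    have h2 := h1.const_mul C
    rw [mul_zero] at h2
    refine squeeze_zero (fun _ => dist_nonneg) (fun n => ?_) h2
    have h3 := hC (φ n.1 - φ n.2)
    rw [map_sub, ← dist_eq_norm] at h3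
    refine le_trans (le_of_eq ?_) h3
    rw [dist_eq_norm]
    congr 1
  obtain ⟨f, hf⟩ := cauchySeq_tendsto_of_complete hcau
  exact ⟨f, hf, le_of_tendsto_of_tendsto' hf.norm (hg.norm.const_mul C) fun n => hC (φ n)⟩

theorem laplacian_eq_fourierMultiplier (T : 𝓢'(Space d, ℂ)) :
    Δ T = ((-(2 * π) ^ 2 : ℝ) : ℂ) •
      TemperedDistribution.fourierMultiplierCLM ℂ (fun x : Space d => ((‖x‖ ^ 2 : ℝ) : ℂ)) T := by
  rw [TemperedDistribution.laplacian_eq_fourierMultiplierCLM, Complex.coe_smul]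

/-- With the Fourier kernel `exp(-2πi x·ξ)`, `-Δ` has symbol `(2π)²‖ξ‖²`. The value `b = 1` serves
the density in `H¹`, and `b = (2π)⁻²` the Bessel potential. -/
theorem fourierMultiplier_affine (b : ℝ) (T : 𝓢'(Space d, ℂ)) :
    TemperedDistribution.fourierMultiplierCLM ℂ
      (fun x : Space d => ((1 + (2 * π) ^ 2 * b * ‖x‖ ^ 2 : ℝ) : ℂ)) T = T - (b : ℂ) • Δ T := by
  have h1 : (fun x : Space d => ((1 + (2 * π) ^ 2 * b * ‖x‖ ^ 2 : ℝ) : ℂ)) =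
      (fun _ => (1 : ℂ)) + (((2 * π) ^ 2 * b : ℝ) : ℂ) • fun x => ((‖x‖ ^ 2 : ℝ) : ℂ) := by
    ext x
    simp
  have hm : (fun x : Space d => ((‖x‖ ^ 2 : ℝ) : ℂ)).HasTemperateGrowth := by fun_prop
  have hm' : ((((2 * π) ^ 2 * b : ℝ) : ℂ) • fun x : Space d =>
      ((‖x‖ ^ 2 : ℝ) : ℂ)).HasTemperateGrowth := by
    change (fun x : Space d => (((2 * π) ^ 2 * b : ℝ) : ℂ) • ((‖x‖ ^ 2 : ℝ) : ℂ)).HasTemperateGrowth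
    fun_prop
  rw [laplacian_eq_fourierMultiplier, h1, TemperedDistribution.fourierMultiplierCLM_apply,
    TemperedDistribution.smulLeftCLM_add (by fun_prop) hm',
    TemperedDistribution.smulLeftCLM_smul hm, add_apply, smul_apply,
    TemperedDistribution.smulLeftCLM_const, one_smul,
    FourierTransform.fourierInv_add, FourierTransform.fourierInv_smul,
    FourierTransform.fourierInv_fourier_eq, smul_smul, sub_eq_add_neg, ← neg_smul,
    ← TemperedDistribution.fourierMultiplierCLM_apply]
  congr 2
  push_cast
  ring

/-- The gradients of Schwartz functions are dense among the square integrable gradients. -/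
theorem exists_schwartz_grad_tendsto [hd : Fact (3 ≤ d)] {u : 𝓢'(Space d, ℂ)}
    {g : VectorL2 d} (hg : ∀ j, ∂_{basisVec j} u = l2Emb d (g j)) :
    ∃ φ : ℕ → 𝓢(Space d, ℂ), Tendsto (fun n => schwartzGrad d (φ n)) atTop (𝓝 g) := by
  have : NeZero d := ⟨by have := hd.out; omega⟩
  obtain ⟨C, -, hC⟩ := exists_norm_sobolev_le_grad d
  let V : Submodule ℂ (VectorL2 d) := (LinearMap.range (schwartzGrad d)).topologicalClosure
  have hVc : IsClosed (V : Set (VectorL2 d)) := Submodule.isClosed_topologicalClosure _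
  have : CompleteSpace V := hVc.completeSpace_coe
  -- The projection `g₀` is itself a gradient, by the Sobolev inequality, so `g - g₀` is a gradient
  -- orthogonal to all Schwartz gradients. It remains to show that it is zero.
  obtain ⟨g₀, hg₀, horth⟩ := Submodule.HasOrthogonalProjection.exists_orthogonal (K := V) g
  obtain ⟨y, hy, hlim⟩ := mem_closure_iff_seq_limit.mp hg₀
  choose φ hφ using hy
  have hφg : Tendsto (fun n => schwartzGrad d (φ n)) atTop (𝓝 g₀) := by
    simpa only [hφ] using hlim
  obtain ⟨f, hf, -⟩ := exists_sobolev_limit hC hφg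
  have hfg := lineDeriv_limit hf hφg
  have hdiff : ∀ j, ∂_{basisVec j} (u - (f : 𝓢'(Space d, ℂ))) = l2Emb d ((g - g₀) j) := by
    intro j
    rw [sub_eq_add_neg, lineDerivOp_add, lineDerivOp_neg, hg, hfg, ← sub_eq_add_neg, ← map_sub]
    rfl
  have hΔ : Δ (u - (f : 𝓢'(Space d, ℂ))) = 0 := by
    ext ψ
    have h1 := inner_schwartzGrad (conjS ψ) (g - g₀) _ hdiff
    have h2 : inner ℂ (schwartzGrad d (conjS ψ)) (g - g₀) = 0 :=
      horth _ (Submodule.le_topologicalClosure _ ⟨_, rfl⟩)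
    rw [h2, conjS_conjS] at h1
    exact neg_eq_zero.mp h1.symm
  have hm : (fun x : Space d => ((‖x‖ ^ 2 : ℝ) : ℂ)).HasTemperateGrowth := by fun_prop
  have hz : g - g₀ = 0 := by
    refine PiLp.ext fun j => ?_
    -- The distribution `u - f` need not be in `L²`, but each component of its gradient is, and is
    -- harmonic because `Δ` commutes with `∂_j`.
    refine eq_zero_of_fourierMultiplier_eq_zero hm (fun x hx => by simpa using hx) _ ?_
    rw [← hdiff, lineDerivOp_comm_fourierMultiplier hm]
    rw [laplacian_eq_fourierMultiplier] at hΔ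
    have hc : ((-(2 * π) ^ 2 : ℝ) : ℂ) ≠ 0 := by
      rw [Complex.ofReal_ne_zero]
      exact neg_ne_zero.mpr (pow_ne_zero 2 (by positivity))
    rw [← inv_smul_smul₀ hc (TemperedDistribution.fourierMultiplierCLM ℂ _ _), hΔ, smul_zero]
    exact lineDerivOp_zero _
  exact ⟨φ, by rwa [sub_eq_zero.mp hz]⟩

/-- Schwartz functions are dense in `H¹`. -/
theorem exists_schwartz_tendsto_H1 [NeZero d] {v : L2 d} {g : VectorL2 d}
    (hg : ∀ j, ∂_{basisVec j} (l2Emb d v) = l2Emb d (g j)) :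
    ∃ φ : ℕ → 𝓢(Space d, ℂ), Tendsto (fun n => ((φ n).toLp 2 : L2 d)) atTop (𝓝 v) ∧
      Tendsto (fun n => schwartzGrad d (φ n)) atTop (𝓝 g) := by
  let e : 𝓢(Space d, ℂ) →ₗ[ℂ] WithLp 2 (L2 d × VectorL2 d) :=
    (WithLp.linearEquiv 2 ℂ (L2 d × VectorL2 d)).symm.toLinearMap ∘ₗ
      (schwartzL2 d).prod (schwartzGrad d)
  let V : Submodule ℂ (WithLp 2 (L2 d × VectorL2 d)) := (LinearMap.range e).topologicalClosure
  have hVc : IsClosed (V : Set (WithLp 2 (L2 d × VectorL2 d))) :=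
    Submodule.isClosed_topologicalClosure _
  have : CompleteSpace V := hVc.completeSpace_coe
  -- The same projection argument in the graph space of the gradient: orthogonality to all pairs
  -- `(φ, ∇φ)` now reads `(1 - Δ)(v - w.fst) = 0`, and the symbol of `1 - Δ` never vanishes.
  obtain ⟨w, hw, horth⟩ := Submodule.HasOrthogonalProjection.exists_orthogonal (K := V)
    (WithLp.toLp 2 (v, g))
  obtain ⟨y, hy, hlim⟩ := mem_closure_iff_seq_limit.mp hw
  choose φ hφ using hy
  have hφw : Tendsto (fun n => e (φ n)) atTop (𝓝 w) := by
    simpa only [hφ] using hlim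
  have h1 : Tendsto (fun n => ((φ n).toLp 2 : L2 d)) atTop (𝓝 w.fst) :=
    ((WithLp.prod_continuous_ofLp 2 _ _).fst.tendsto w).comp hφw
  have h2 : Tendsto (fun n => schwartzGrad d (φ n)) atTop (𝓝 w.snd) :=
    ((WithLp.prod_continuous_ofLp 2 _ _).snd.tendsto w).comp hφw
  have h3 := lineDeriv_limit h1 h2
  have hdiff : ∀ j, ∂_{basisVec j} (l2Emb d (v - w.fst)) = l2Emb d ((g - w.snd) j) := by
    intro j
    rw [map_sub, sub_eq_add_neg, lineDerivOp_add, lineDerivOp_neg, hg]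
    change _ + -∂_{basisVec j} (Lp.toTemperedDistribution w.fst) = _
    rw [h3, ← sub_eq_add_neg, ← map_sub]
    rfl
  have hm : (fun x : Space d => ((1 + (2 * π) ^ 2 * 1 * ‖x‖ ^ 2 : ℝ) : ℂ)).HasTemperateGrowth := by
    fun_prop
  have hz : v - w.fst = 0 := by
    refine eq_zero_of_fourierMultiplier_eq_zero hm (fun x _ => ?_) _ ?_
    · rw [Complex.ofReal_ne_zero]
      positivity
    · ext ψ
      have h4 : inner ℂ (e (conjS ψ)) (WithLp.toLp 2 (v, g) - w) = 0 :=
        horth _ (Submodule.le_topologicalClosure _ ⟨_, rfl⟩)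
      have h5 : inner ℂ ((conjS ψ).toLp 2 : L2 d) (v - w.fst) +
          inner ℂ (schwartzGrad d (conjS ψ)) (g - w.snd) = 0 := h4
      rw [inner_schwartz_eq, inner_schwartzGrad _ _ _ hdiff, conjS_conjS,
        ← sub_eq_add_neg] at h5
      rw [fourierMultiplier_affine, Complex.ofReal_one, one_smul]
      exact h5
  have hz' : g - w.snd = 0 := by
    refine PiLp.ext fun j => l2Emb_injective d ?_
    rw [← hdiff, hz, map_zero]
    exact (lineDerivOp_zero _).trans (map_zero _).symm
  refine ⟨φ, ?_, ?_⟩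
  · rwa [sub_eq_zero.mp hz]
  · rwa [sub_eq_zero.mp hz']

/-- A Schwartz sequence converging in `H¹` also converges in `L^{2d/(d-2)}`, and the two limits
agree as distributions. -/
theorem mem_hdot_of_H1 [hd : Fact (3 ≤ d)] {v : L2 d} {g : VectorL2 d}
    (hg : ∀ j, ∂_{basisVec j} (l2Emb d v) = l2Emb d (g j)) : l2Emb d v ∈ hdot d := by
  have : NeZero d := ⟨by have := hd.out; omega⟩
  obtain ⟨C, -, hC⟩ := exists_norm_sobolev_le_grad d
  obtain ⟨φ, h1, h2⟩ := exists_schwartz_tendsto_H1 hg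
  obtain ⟨f, hf, -⟩ := exists_sobolev_limit hC h2
  refine ⟨⟨f, ?_⟩, fun j => ⟨g j, hg j⟩⟩
  have h3 := ((Lp.toTemperedDistributionCLM ℂ (volume : Measure (Space d))
    (sobolevExp d)).continuous.tendsto f).comp hf
  have h4 := (continuous_l2Emb.tendsto v).comp h1
  refine tendsto_nhds_unique h4 (h3.congr fun n => ?_)
  change (((φ n).toLp (sobolevExp d) : Lp ℂ (sobolevExp d) volume) : 𝓢'(Space d, ℂ))
    = l2Emb d ((φ n).toLp 2)
  rw [Lp.toTemperedDistribution_toLp_eq, l2Emb_toLp]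

end Gradient

/-! ### Uniform ellipticity -/

section Ellipticity

open Filter Topology

variable {d : ℕ} (M : Medium d)

theorem norm_le_bracket (x : Space d) : ‖x‖ ≤ bracket x := by
  unfold bracket
  exact Real.le_sqrt_of_sq_le (by linarith)

theorem exists_small_of_decay {f : Space d → ℝ} {c ρ ε : ℝ} (hρ : 0 < ρ) (hε : 0 < ε)
    (h : ∀ x, ‖f x‖ ≤ c * bracket x ^ (-ρ)) : ∃ A : ℝ, ∀ x, A ≤ ‖x‖ → |f x| ≤ ε := by
  have h1 : Tendsto (fun r : ℝ => |c| * r ^ (-ρ)) atTop (𝓝 (|c| * 0)) :=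
    (tendsto_rpow_neg_atTop hρ).const_mul _
  rw [mul_zero] at h1
  obtain ⟨A, hA⟩ := eventually_atTop.mp (h1.eventually (ge_mem_nhds hε))
  refine ⟨A, fun x hx => ?_⟩
  refine (h x).trans ((mul_le_mul_of_nonneg_right (le_abs_self c) ?_).trans
    (hA _ (hx.trans (norm_le_bracket x))))
  exact Real.rpow_nonneg (zero_le_one.trans (one_le_bracket x)) _

/-- By Cauchy–Schwarz `(∑ |v_j|)² ≤ d ∑ v_j²`, so the tolerance `1 / (2d)` costs at most half of the
identity. -/
theorem quad_far {A : Matrix (Fin d) (Fin d) ℝ}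
    (hA : ∀ j k, |A j k - if j = k then 1 else 0| ≤ 1 / (2 * d)) (v : Fin d → ℝ) :
    1 / 2 * ∑ j, v j ^ 2 ≤ v ⬝ᵥ A.mulVec v := by
  have h1 : v ⬝ᵥ A.mulVec v =
      ∑ j, v j ^ 2 + ∑ j, ∑ k, (A j k - if j = k then 1 else 0) * (v j * v k) := by
    simp only [dotProduct, Matrix.mulVec, sub_mul, Finset.sum_sub_distrib, ite_mul, one_mul,
      zero_mul, Finset.sum_ite_eq, Finset.mem_univ, if_true, Finset.mul_sum]
    rw [add_sub_assoc', eq_sub_iff_add_eq, add_comm]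
    congr 1
    · exact Finset.sum_congr rfl fun j _ => (sq _).symm
    · exact Finset.sum_congr rfl fun j _ => Finset.sum_congr rfl fun k _ => by ring
  have h2 : |∑ j, ∑ k, (A j k - if j = k then 1 else 0) * (v j * v k)| ≤
      1 / (2 * d) * (∑ j, |v j|) ^ 2 := by
    rw [sq, Finset.sum_mul_sum, Finset.mul_sum]
    refine (Finset.abs_sum_le_sum_abs _ _).trans (Finset.sum_le_sum fun j _ => ?_)
    rw [Finset.mul_sum]
    refine (Finset.abs_sum_le_sum_abs _ _).trans (Finset.sum_le_sum fun k _ => ?_)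
    rw [abs_mul, abs_mul]
    exact mul_le_mul_of_nonneg_right (hA j k) (by positivity)
  have h3 : (∑ j, |v j|) ^ 2 ≤ d * ∑ j, v j ^ 2 := by
    simpa using sq_sum_le_card_mul_sum_sq (s := Finset.univ) (f := fun j => |v j|)
  have h4 : 1 / (2 * d) * (∑ j, |v j|) ^ 2 ≤ 1 / 2 * ∑ j, v j ^ 2 := by
    rcases Nat.eq_zero_or_pos d with h0 | h0
    · subst h0
      simp
    · have : (0 : ℝ) < d := by exact_mod_cast h0
      calc 1 / (2 * d) * (∑ j, |v j|) ^ 2 ≤ 1 / (2 * d) * (d * ∑ j, v j ^ 2) := by gcongr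
        _ = 1 / 2 * ∑ j, v j ^ 2 := by field_simp
  have h5 := neg_abs_le (∑ j, ∑ k, (A j k - if j = k then 1 else 0) * (v j * v k))
  linarith

theorem Medium.exists_near_identity : ∃ R : ℝ, ∀ x, R ≤ ‖x‖ → ∀ j k,
    |M.G x j k - if j = k then 1 else 0| ≤ 1 / (2 * d) := by
  rcases Nat.eq_zero_or_pos d with h0 | h0
  · subst h0
    exact ⟨0, fun x _ j => j.elim0⟩
  have hd : (0 : ℝ) < d := by exact_mod_cast h0
  have h1 : ∀ p : Fin d × Fin d, ∃ A : ℝ, ∀ x, A ≤ ‖x‖ →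
      |M.G x p.1 p.2 - if p.1 = p.2 then 1 else 0| ≤ 1 / (2 * d) := by
    intro p
    obtain ⟨c, hc⟩ := M.G_longRange p.1 p.2 0
    exact exists_small_of_decay (f := fun x => M.G x p.1 p.2 - if p.1 = p.2 then 1 else 0)
      M.ρ_pos (by positivity) (fun x => by simpa using hc x)
  choose A hA using h1
  refine ⟨∑ p, |A p|, fun x hx j k => hA (j, k) x (le_trans ?_ hx)⟩
  exact (le_abs_self _).trans
    (Finset.single_le_sum (f := fun p => |A p|) (fun p _ => abs_nonneg _) (Finset.mem_univ (j, k)))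

/-- The matrices `G(x)` are uniformly positive. -/
theorem Medium.exists_elliptic : ∃ c : ℝ, 0 < c ∧ ∀ x (v : Fin d → ℝ),
    c * ∑ j, v j ^ 2 ≤ v ⬝ᵥ (M.G x).mulVec v := by
  obtain ⟨R, hR⟩ := M.exists_near_identity
  let K : Set (Space d × Space d) := Metric.closedBall 0 R ×ˢ Metric.sphere 0 1
  have hK : IsCompact K := (isCompact_closedBall _ _).prod (isCompact_sphere _ _)
  let q : Space d × Space d → ℝ := fun p => ∑ j, p.2 j * ∑ k, M.G p.1 j k * p.2 k
  have hq : Continuous q := by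
    have : ∀ j k, Continuous fun x => M.G x j k := fun j k => (M.G_smooth j k).continuous
    fun_prop
  have hpos : ∀ p ∈ K, 0 < q p := by
    rintro ⟨x, v⟩ ⟨-, hv⟩
    have hne : (v : Fin d → ℝ) ≠ 0 := by
      intro h0
      have : v = 0 := by ext j; exact congrFun h0 j
      simp [this] at hv
    simpa only [star_trivial, dotProduct, Matrix.mulVec] using
      (M.G_posDef x).dotProduct_mulVec_pos hne
  obtain ⟨m, hm0, hm⟩ : ∃ m : ℝ, 0 < m ∧ ∀ p ∈ K, m ≤ q p := by
    rcases K.eq_empty_or_nonempty with h | h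
    · exact ⟨1, one_pos, by simp [h]⟩
    · obtain ⟨p, hp, hmin⟩ := hK.exists_isMinOn h hq.continuousOn
      exact ⟨q p, hpos p hp, fun p' hp' => hmin hp'⟩
  -- `m` is the minimum over the compact set of `x` in a ball and unit vectors `v`; `1 / 2` is the
  -- bound outside the ball, where `G` is close to the identity.
  refine ⟨min m (1 / 2), lt_min hm0 (by norm_num), fun x v => ?_⟩
  have hS : 0 ≤ ∑ j, v j ^ 2 := Finset.sum_nonneg fun j _ => sq_nonneg _
  by_cases hx : R ≤ ‖x‖
  · exact (mul_le_mul_of_nonneg_right (min_le_right _ _) hS).trans (quad_far (hR x hx) v)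
  · refine (mul_le_mul_of_nonneg_right (min_le_left _ _) hS).trans ?_
    set w : Space d := WithLp.toLp 2 v with hw
    have hnorm : ∑ j, v j ^ 2 = ‖w‖ ^ 2 := by
      rw [EuclideanSpace.norm_sq_eq]
      simp [hw]
    by_cases hw0 : w = 0
    · have hv0 : v = 0 := by
        ext j
        exact congrArg (fun u : Space d => u j) hw0
      simp [hv0]
    · have hn : 0 < ‖w‖ := norm_pos_iff.mpr hw0
      have h1 := hm (x, ‖w‖⁻¹ • w) ⟨by simpa using (not_le.mp hx).le, by
        simp [norm_smul, hn.ne']⟩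
      have h2 : q (x, ‖w‖⁻¹ • w) * ‖w‖ ^ 2 = v ⬝ᵥ (M.G x).mulVec v := by
        simp only [q, dotProduct, Matrix.mulVec, Finset.sum_mul, Finset.mul_sum]
        refine Finset.sum_congr rfl fun j _ => Finset.sum_congr rfl fun k _ => ?_
        simp only [PiLp.smul_apply, smul_eq_mul, hw]
        have hn' : ‖(WithLp.toLp 2 v : Space d)‖ ≠ 0 := hn.ne'
        field_simp
      rw [hnorm, ← h2]
      exact mul_le_mul_of_nonneg_right h1 (sq_nonneg _)

theorem norm_sq_L2_eq (f : L2 d) : ‖f‖ ^ 2 = ∫ x, ((f x).re ^ 2 + (f x).im ^ 2) := by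
  rw [@norm_sq_eq_re_inner ℂ, L2.inner_def]
  have h := L2.integrable_inner (𝕜 := ℂ) f f
  change (∫ x, inner ℂ (f x) (f x)).re = _
  rw [← Complex.reCLM_apply, ← ContinuousLinearMap.integral_comp_comm _ h]
  refine integral_congr_ae (Eventually.of_forall fun x => ?_)
  simp only [RCLike.inner_apply, Complex.reCLM_apply, Complex.mul_conj, Complex.ofReal_re,
    Complex.normSq_apply]
  ring

theorem integrable_norm_sq_L2 (f : L2 d) :
    Integrable fun x => ((f x).re ^ 2 + (f x).im ^ 2) := by
  have h := (L2.integrable_inner (𝕜 := ℂ) f f).re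
  refine h.congr (Eventually.of_forall fun x => ?_)
  simp only [RCLike.inner_apply, Complex.mul_conj, RCLike.re_to_complex, Complex.ofReal_re,
    Complex.normSq_apply]
  ring

/-- The quadratic form of `G` on vector fields is bounded from below. -/
theorem Medium.le_re_inner_sum {c : ℝ}
    (hc : ∀ x (v : Fin d → ℝ), c * ∑ j, v j ^ 2 ≤ v ⬝ᵥ (M.G x).mulVec v) (F : Fin d → L2 d) :
    c * ∑ j, ‖F j‖ ^ 2 ≤ (∑ j, ∑ k, inner ℂ (F j) (M.mulG j k (F k))).re := by
  have hint : Integrable (fun x => ∑ j, ∑ k, (M.G x j k : ℂ) * (F k x * star (F j x))) :=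
    integrable_finsetSum _ fun j _ => integrable_finsetSum _ fun k _ =>
      integrable_mulG M j k _ _
  have hint' := (hint.congr (Eventually.of_forall fun x =>
    quad_eq M x (fun j => F j x))).re
  simp only [RCLike.re_to_complex, Complex.ofReal_re] at hint'
  rw [inner_sum_eq, Complex.ofReal_re]
  simp only [norm_sq_L2_eq]
  rw [← integral_finsetSum _ fun j _ => integrable_norm_sq_L2 (F j), ← integral_const_mul]
  refine integral_mono ((integrable_finsetSum _ fun j _ =>
    integrable_norm_sq_L2 (F j)).const_mul c) hint' fun x => ?_
  have h1 := hc x fun j => (F j x).re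
  have h2 := hc x fun j => (F j x).im
  simp only [Finset.sum_add_distrib, mul_add]
  exact add_le_add h1 h2

theorem Medium.exists_re_inner_sum_le : ∃ C : ℝ, 0 ≤ C ∧ ∀ F : VectorL2 d,
    (∑ j, ∑ k, inner ℂ (F j) (M.mulG j k (F k))).re ≤ C * ‖F‖ ^ 2 := by
  refine ⟨∑ j, ∑ k, ‖M.mulG j k‖, by positivity, fun F => ?_⟩
  refine (Complex.re_le_norm _).trans ((norm_sum_le _ _).trans ?_)
  rw [Finset.sum_mul]
  refine Finset.sum_le_sum fun j _ => (norm_sum_le _ _).trans ?_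
  rw [Finset.sum_mul]
  refine Finset.sum_le_sum fun k _ => (norm_inner_le_norm _ _).trans ?_
  have h1 := (M.mulG j k).le_opNorm (F k)
  calc ‖F j‖ * ‖M.mulG j k (F k)‖ ≤ ‖F‖ * (‖M.mulG j k‖ * ‖F‖) := by
        refine mul_le_mul (PiLp.norm_apply_le F j) (h1.trans ?_) (norm_nonneg _) (norm_nonneg _)
        exact mul_le_mul_of_nonneg_left (PiLp.norm_apply_le F k) (norm_nonneg _)
    _ = ‖M.mulG j k‖ * ‖F‖ ^ 2 := by ring

end Ellipticity

/-! ### Completeness of the energy space and density of the Schwartz functions -/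

section EnergySpace

open Filter Topology

variable {d : ℕ} [hd : Fact (3 ≤ d)] {M : Medium d}

/-- The gradient of an element of `Ḣ¹`. -/
def HDot.grad : HDot M →ₗ[ℂ] VectorL2 d :=
  (WithLp.linearEquiv 2 ℂ (Fin d → L2 d)).symm.toLinearMap ∘ₗ LinearMap.pi HDot.partialDeriv

theorem HDot.grad_apply (u : HDot M) (j : Fin d) : u.grad j = u.partialDeriv j := rfl

theorem HDot.l2Emb_grad (u : HDot M) (j : Fin d) :
    ∂_{basisVec j} u.dist = l2Emb d (u.grad j) := (HDot.partialDeriv_spec j u).symm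

theorem HDot.grad_eq {u : HDot M} {g : VectorL2 d}
    (h : ∀ j, ∂_{basisVec j} u.dist = l2Emb d (g j)) : u.grad = g :=
  PiLp.ext fun j => l2Emb_injective d (by rw [← h, HDot.l2Emb_grad])

theorem HDot.norm_sq_eq (u : HDot M) :
    ‖u‖ ^ 2 = (∑ j, ∑ k, inner ℂ (u.grad j) (M.mulG j k (u.grad k))).re :=
  norm_sq_eq_re_inner (𝕜 := ℂ) u

theorem HDot.exists_norm_grad_le (M : Medium d) :
    ∃ C : ℝ, 0 ≤ C ∧ ∀ u : HDot M, ‖u.grad‖ ≤ C * ‖u‖ := by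
  obtain ⟨c, hc0, hc⟩ := M.exists_elliptic
  refine ⟨(Real.sqrt c)⁻¹, by positivity, fun u => ?_⟩
  rw [inv_mul_eq_div, le_div_iff₀ (Real.sqrt_pos.mpr hc0)]
  refine le_of_sq_le_sq ?_ (norm_nonneg _)
  rw [mul_pow, Real.sq_sqrt hc0.le, HDot.norm_sq_eq, mul_comm, PiLp.norm_sq_eq_of_L2]
  exact M.le_re_inner_sum hc _

theorem HDot.exists_norm_le_grad (M : Medium d) :
    ∃ C : ℝ, 0 ≤ C ∧ ∀ u : HDot M, ‖u‖ ≤ C * ‖u.grad‖ := by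
  obtain ⟨C, hC0, hC⟩ := M.exists_re_inner_sum_le
  refine ⟨Real.sqrt C, by positivity, fun u => ?_⟩
  refine le_of_sq_le_sq ?_ (by positivity)
  rw [mul_pow, Real.sq_sqrt hC0, HDot.norm_sq_eq]
  exact hC u.grad

/-- A Schwartz function as an element of `Ḣ¹`. -/
def schwartzHDot (M : Medium d) (φ : 𝓢(Space d, ℂ)) : HDot M :=
  (⟨(φ : 𝓢'(Space d, ℂ)), schwartz_mem_hdot φ⟩ : hdot d)

theorem schwartzHDot_dist (φ : 𝓢(Space d, ℂ)) :
    (schwartzHDot M φ).dist = (φ : 𝓢'(Space d, ℂ)) := rfl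

theorem schwartzHDot_grad (φ : 𝓢(Space d, ℂ)) : (schwartzHDot M φ).grad = schwartzGrad d φ := by
  refine HDot.grad_eq fun j => ?_
  rw [schwartzHDot_dist, lineDerivOp_toTemperedDistributionCLM_eq, schwartzGrad_apply, l2Emb_toLp]

theorem HDot.tendsto_of_grad {u : ℕ → HDot M} {w : HDot M}
    (h : Tendsto (fun n => (u n).grad) atTop (𝓝 w.grad)) : Tendsto u atTop (𝓝 w) := by
  obtain ⟨C, -, hC⟩ := HDot.exists_norm_le_grad M
  rw [tendsto_iff_norm_sub_tendsto_zero] at h ⊢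
  have h1 := h.const_mul C
  rw [mul_zero] at h1
  refine squeeze_zero (fun _ => norm_nonneg _) (fun n => ?_) h1
  rw [← map_sub]
  exact hC _

theorem HDot.tendsto_grad {u : ℕ → HDot M} {w : HDot M} (h : Tendsto u atTop (𝓝 w)) :
    Tendsto (fun n => (u n).grad) atTop (𝓝 w.grad) := by
  obtain ⟨C, -, hC⟩ := HDot.exists_norm_grad_le M
  rw [tendsto_iff_norm_sub_tendsto_zero] at h ⊢
  have h1 := h.const_mul C
  rw [mul_zero] at h1
  refine squeeze_zero (fun _ => norm_nonneg _) (fun n => ?_) h1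
  rw [← map_sub]
  exact hC _

theorem HDot.exists_schwartz_tendsto (u : HDot M) :
    ∃ φ : ℕ → 𝓢(Space d, ℂ), Tendsto (fun n => schwartzHDot M (φ n)) atTop (𝓝 u) := by
  obtain ⟨φ, hφ⟩ := exists_schwartz_grad_tendsto u.l2Emb_grad
  exact ⟨φ, HDot.tendsto_of_grad (by simpa only [schwartzHDot_grad] using hφ)⟩

/-- The Sobolev inequality provides the `L^{2d/(d-2)}` primitive that membership in `Ḣ¹` requires.
-/
theorem exists_hdot_of_tendsto (M : Medium d) {φ : ℕ → 𝓢(Space d, ℂ)} {g : VectorL2 d}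
    (hg : Tendsto (fun n => schwartzGrad d (φ n)) atTop (𝓝 g)) :
    ∃ u : HDot M, u.grad = g := by
  obtain ⟨C, -, hC⟩ := exists_norm_sobolev_le_grad d
  obtain ⟨f, hf, -⟩ := exists_sobolev_limit hC hg
  have h1 := lineDeriv_limit hf hg
  exact ⟨(⟨(f : 𝓢'(Space d, ℂ)), ⟨f, rfl⟩, fun j => ⟨g j, h1 j⟩⟩ : hdot d), HDot.grad_eq h1⟩

/-- The gradients of a Cauchy sequence converge in `L²`. To see that the limit is a gradient, each
`u n` is replaced by a Schwartz function whose gradient is within `1 / (n + 1)`. -/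
instance : CompleteSpace (HDot M) := by
  refine Metric.complete_of_cauchySeq_tendsto fun u hu => ?_
  obtain ⟨C, -, hC⟩ := HDot.exists_norm_grad_le M
  have hcau : CauchySeq fun n => (u n).grad := by
    rw [cauchySeq_iff_tendsto_dist_atTop_0] at hu ⊢
    have h2 := hu.const_mul C
    rw [mul_zero] at h2
    refine squeeze_zero (fun _ => dist_nonneg) (fun n => ?_) h2
    rw [dist_eq_norm, dist_eq_norm, ← map_sub]
    exact hC _
  obtain ⟨g, hg⟩ := cauchySeq_tendsto_of_complete hcau
  have happ : ∀ n, ∃ φ : 𝓢(Space d, ℂ), ‖schwartzGrad d φ - (u n).grad‖ < 1 / ((n : ℝ) + 1) := by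
    intro n
    obtain ⟨φ, hφ⟩ := exists_schwartz_grad_tendsto (u n).l2Emb_grad
    rw [tendsto_iff_norm_sub_tendsto_zero] at hφ
    obtain ⟨k, hk⟩ := (hφ.eventually (gt_mem_nhds (by positivity : (0 : ℝ) < 1 / (n + 1)))).exists
    exact ⟨φ k, hk⟩
  choose φ hφ using happ
  have h0 : Tendsto (fun n => schwartzGrad d (φ n) - (u n).grad) atTop (𝓝 0) :=
    squeeze_zero_norm (fun n => (hφ n).le) tendsto_one_div_add_atTop_nhds_zero_nat
  have h1 : Tendsto (fun n => schwartzGrad d (φ n)) atTop (𝓝 g) := by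
    simpa using h0.add hg
  obtain ⟨w, hw⟩ := exists_hdot_of_tendsto M h1
  exact ⟨w, HDot.tendsto_of_grad (hw ▸ hg)⟩

/-- The Sobolev limit of Schwartz approximants has the same gradient as `u`, hence equals `u`
because an element of `Ḣ¹` with zero gradient is zero. -/
theorem HDot.exists_sobolev (M : Medium d) : ∃ C : ℝ, 0 ≤ C ∧ ∀ u : HDot M,
    ∃ f : Lp ℂ (sobolevExp d) (volume : Measure (Space d)),
      u.dist = (f : 𝓢'(Space d, ℂ)) ∧ ‖f‖ ≤ C * ‖u.grad‖ := by
  obtain ⟨C, hC0, hC⟩ := exists_norm_sobolev_le_grad d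
  refine ⟨C, hC0, fun u => ?_⟩
  obtain ⟨φ, hφ⟩ := exists_schwartz_grad_tendsto u.l2Emb_grad
  obtain ⟨f, hf, hfb⟩ := exists_sobolev_limit hC hφ
  refine ⟨f, ?_, hfb⟩
  have h1 := lineDeriv_limit hf hφ
  let w : HDot M := (⟨(f : 𝓢'(Space d, ℂ)), ⟨f, rfl⟩, fun j => ⟨u.grad j, h1 j⟩⟩ : hdot d)
  have hw : w.grad = u.grad := HDot.grad_eq h1
  have h2 : (u - w).dist = 0 := by
    refine eq_zero_of_mem_hdot (u - w).dist_mem fun j => ?_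
    rw [HDot.l2Emb_grad, map_sub, hw, sub_self]
    exact map_zero (l2Emb d)
  rw [map_sub, sub_eq_zero] at h2
  exact h2

/-- Needed for the closedness of `𝒜`, whose domain is defined by distributional conditions. -/
theorem HDot.tendsto_dist {u : ℕ → HDot M} {w : HDot M} (h : Tendsto u atTop (𝓝 w)) :
    Tendsto (fun n => (u n).dist) atTop (𝓝 w.dist) := by
  obtain ⟨C, hC0, hC⟩ := HDot.exists_sobolev M
  choose f hf hfb using fun n => hC (u n - w)
  have h1 := HDot.tendsto_grad h
  rw [tendsto_iff_norm_sub_tendsto_zero] at h1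
  have h2 : Tendsto f atTop (𝓝 0) := by
    refine squeeze_zero_norm (fun n => ?_) (by simpa using h1.const_mul C)
    rw [← map_sub]
    exact hfb n
  have h3 := ((Lp.toTemperedDistributionCLM ℂ (volume : Measure (Space d))
    (sobolevExp d)).continuous.tendsto 0).comp h2
  rw [map_zero] at h3
  have h4 := h3.add_const w.dist
  rw [zero_add] at h4
  refine h4.congr fun n => ?_
  have h5 := hf n
  rw [map_sub, sub_eq_iff_eq_add] at h5
  exact h5.symm

theorem exists_schwartzPair_tendsto (U : Energy M) : ∃ f g : ℕ → 𝓢(Space d, ℂ),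
    Tendsto (fun n => schwartzPair M (f n) (g n)) atTop (𝓝 U) := by
  obtain ⟨f, hf⟩ := U.fst.exists_schwartz_tendsto
  obtain ⟨g, hg⟩ := schwartzL2_dense U.snd
  exact ⟨f, g, ((WithLp.prod_continuous_toLp 2 (HDot M) (L2 d)).tendsto _).comp
    (hf.prodMk_nhds hg)⟩

theorem dense_schwartzPair (M : Medium d) :
    Dense {U : Energy M | ∃ f g : 𝓢(Space d, ℂ), U = schwartzPair M f g} := by
  intro U
  obtain ⟨f, g, h⟩ := exists_schwartzPair_tendsto U
  exact mem_closure_of_tendsto h (Eventually.of_forall fun n => ⟨f n, g n, rfl⟩)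

end EnergySpace

/-! ### Coefficients of temperate growth -/

section Coefficients

open Filter Topology

theorem _root_.Function.HasTemperateGrowth.fderiv_apply {E F : Type*} [NormedAddCommGroup E]
    [NormedSpace ℝ E] [NormedAddCommGroup F] [NormedSpace ℝ F] {f : E → F}
    (hf : f.HasTemperateGrowth) (m : E) : (fun x => fderiv ℝ f x m).HasTemperateGrowth := by
  have h1 : (fderiv ℝ f).HasTemperateGrowth := by
    refine ⟨hf.1.fderiv_right (by simp), fun n => ?_⟩
    obtain ⟨k, C, h⟩ := hf.2 (n + 1)
    refine ⟨k, C, fun x => ?_⟩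
    rw [norm_iteratedFDeriv_fderiv]
    exact h x
  exact ((ContinuousLinearMap.apply ℝ F m).hasTemperateGrowth).comp h1

theorem bracket_rpow_decay {d : ℕ} {s c y : ℝ} (hs : s ≤ 0) {x : Space d}
    (h : y ≤ c * bracket x ^ s) : y ≤ |c| := by
  have h1 : bracket x ^ s ≤ 1 := Real.rpow_le_one_of_one_le_of_nonpos (one_le_bracket x) hs
  have h0 : 0 ≤ bracket x ^ s := Real.rpow_nonneg (zero_le_one.trans (one_le_bracket x)) s
  calc y ≤ c * bracket x ^ s := h
    _ ≤ |c| * bracket x ^ s := mul_le_mul_of_nonneg_right (le_abs_self c) h0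
    _ ≤ |c| * 1 := mul_le_mul_of_nonneg_left h1 (abs_nonneg c)
    _ = |c| := mul_one _

variable {d : ℕ} (M : Medium d)

theorem Medium.temperate_G_real (j k : Fin d) : (fun x => M.G x j k).HasTemperateGrowth := by
  have h1 : (fun x => M.G x j k - if j = k then 1 else 0).HasTemperateGrowth := by
    refine ⟨(M.G_smooth j k).sub contDiff_const, fun n => ?_⟩
    obtain ⟨c, hc⟩ := M.G_longRange j k n
    refine ⟨0, |c|, fun x => ?_⟩
    rw [pow_zero, mul_one]
    exact bracket_rpow_decay (by have := M.ρ_pos; have := Nat.cast_nonneg (α := ℝ) n; linarith)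
      (hc x)
  convert h1.add (Function.HasTemperateGrowth.const (if j = k then (1 : ℝ) else 0)) using 1
  ext x
  simp

theorem Medium.temperate_G (j k : Fin d) : (fun x => (M.G x j k : ℂ)).HasTemperateGrowth := by
  have := M.temperate_G_real j k
  fun_prop

/-- The derivative `∂_l G_{jk}`. -/
def Medium.dG (l j k : Fin d) (x : Space d) : ℂ :=
  fderiv ℝ (fun x => (M.G x j k : ℂ)) x (basisVec l)

theorem Medium.temperate_dG (l j k : Fin d) : (M.dG l j k).HasTemperateGrowth :=
  (M.temperate_G j k).fderiv_apply (basisVec l)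

theorem Medium.memLp_dG (l j k : Fin d) :
    MemLp (M.dG l j k) ∞ (volume : Measure (Space d)) := by
  obtain ⟨c, hc⟩ := M.G_longRange j k 1
  refine memLp_top_of_bound (C := |c|) (M.temperate_dG l j k).1.continuous.aestronglyMeasurable
    (Eventually.of_forall fun x => ?_)
  have hdiff : DifferentiableAt ℝ (fun y => M.G y j k) x :=
    (M.G_smooth j k).differentiable (by simp) x
  have h2 : fderiv ℝ (fun y => M.G y j k - if j = k then 1 else 0) x
      = fderiv ℝ (fun y => M.G y j k) x := fderiv_sub_const _
  have h3 : HasFDerivAt (fun x => (M.G x j k : ℂ))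
      (Complex.ofRealCLM.comp (fderiv ℝ (fun y => M.G y j k) x)) x :=
    Complex.ofRealCLM.hasFDerivAt.comp x hdiff.hasFDerivAt
  have h4 : ‖fderiv ℝ (fun y => M.G y j k) x‖ ≤ |c| := by
    rw [← h2, ← norm_iteratedFDeriv_one]
    refine bracket_rpow_decay (by have := M.ρ_pos; push_cast; linarith) (hc x)
  rw [Medium.dG, h3.fderiv, ContinuousLinearMap.comp_apply, Complex.ofRealCLM_apply,
    Complex.norm_real]
  refine ((fderiv ℝ (fun y => M.G y j k) x).le_opNorm _).trans ?_
  rw [show ‖(basisVec l : Space d)‖ = 1 by simp, mul_one]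
  exact h4

/-- Multiplication by `∂_l G_{jk}`, on `L²`. -/
def Medium.mulDG (l j k : Fin d) : L2 d →L[ℂ] L2 d := mulL2 (M.dG l j k) (M.memLp_dG l j k)

theorem l2Emb_mulL2 {g : Space d → ℂ} (hg : MemLp g ∞ (volume : Measure (Space d)))
    (hg' : g.HasTemperateGrowth) (f : L2 d) :
    l2Emb d (mulL2 g hg f) = TemperedDistribution.smulLeftCLM ℂ g (l2Emb d f) := by
  ext ψ
  rw [TemperedDistribution.smulLeftCLM_apply_apply, l2Emb_apply, l2Emb_apply]
  refine integral_congr_ae ?_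
  filter_upwards [mulL2_coeFn g hg f] with x hx
  rw [hx, SchwartzMap.smulLeftCLM_apply_apply hg', smul_eq_mul]
  ring

/-- The product rule for Schwartz functions. -/
theorem schwartz_lineDerivOp_smulLeft {g : Space d → ℂ} (hg : g.HasTemperateGrowth) (m : Space d)
    (φ : 𝓢(Space d, ℂ)) : ∂_{m} (SchwartzMap.smulLeftCLM ℂ g φ) =
      SchwartzMap.smulLeftCLM ℂ (fun x => fderiv ℝ g x m) φ +
        SchwartzMap.smulLeftCLM ℂ g (∂_{m} φ) := by
  ext x
  rw [SchwartzMap.lineDerivOp_apply_eq_fderiv, SchwartzMap.smulLeftCLM_apply hg, add_apply,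
    SchwartzMap.smulLeftCLM_apply_apply (hg.fderiv_apply m), SchwartzMap.smulLeftCLM_apply_apply hg,
    SchwartzMap.lineDerivOp_apply_eq_fderiv]
  have h := ((hg.1.differentiable (by simp) x).hasFDerivAt.mul (φ.hasFDerivAt x)).fderiv
  change fderiv ℝ (fun x => g x * φ x) x m = _
  change fderiv ℝ (fun x => g x * φ x) x = _ at h
  rw [h]
  simp [mul_comm, add_comm]

/-- The product rule for distributions. -/
theorem lineDerivOp_smulLeft {g : Space d → ℂ} (hg : g.HasTemperateGrowth) (m : Space d)
    (T : 𝓢'(Space d, ℂ)) : ∂_{m} (TemperedDistribution.smulLeftCLM ℂ g T) =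
      TemperedDistribution.smulLeftCLM ℂ (fun x => fderiv ℝ g x m) T +
        TemperedDistribution.smulLeftCLM ℂ g (∂_{m} T) := by
  ext ψ
  rw [add_apply, TemperedDistribution.lineDerivOp_apply_apply,
    TemperedDistribution.smulLeftCLM_apply_apply, TemperedDistribution.smulLeftCLM_apply_apply,
    TemperedDistribution.smulLeftCLM_apply_apply, TemperedDistribution.lineDerivOp_apply_apply,
    schwartz_lineDerivOp_smulLeft hg]
  simp only [map_neg, map_add]
  abel

theorem Medium.H0_eq (T : 𝓢'(Space d, ℂ)) : M.H0 T = -∑ j, ∑ k, ∂_{basisVec j}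
    (TemperedDistribution.smulLeftCLM ℂ (fun x => (M.G x j k : ℂ)) (∂_{basisVec k} T)) := by
  simp [Medium.H0]

theorem Medium.H0_apply (T : 𝓢'(Space d, ℂ)) (ψ : 𝓢(Space d, ℂ)) : M.H0 T ψ = ∑ j, ∑ k,
    TemperedDistribution.smulLeftCLM ℂ (fun x => (M.G x j k : ℂ)) (∂_{basisVec k} T)
      (∂_{basisVec j} ψ) := by
  rw [M.H0_eq, neg_apply, sum_apply]
  simp only [sum_apply, TemperedDistribution.lineDerivOp_apply_apply, map_neg,
    Finset.sum_neg_distrib, neg_neg]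

end Coefficients

/-! ### Green's formula -/

section Green

open Filter Topology

variable {d : ℕ} [hd : Fact (3 ≤ d)] {M : Medium d}

/-- This is the weak form of `H₀`: moving the outer derivative onto the test function cancels the
minus sign of `-div`. -/
theorem inner_schwartzHDot (φ : 𝓢(Space d, ℂ)) (u : HDot M) :
    inner ℂ (schwartzHDot M φ) u = M.H0 u.dist (conjS φ) := by
  rw [HDot.inner_eq, M.H0_apply]
  refine Finset.sum_congr rfl fun j _ => Finset.sum_congr rfl fun k _ => ?_
  have h1 : (schwartzHDot M φ).partialDeriv j = (∂_{basisVec j} φ).toLp 2 := by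
    rw [← HDot.grad_apply, schwartzHDot_grad, schwartzGrad_apply]
  rw [h1, inner_schwartz_eq, lineDerivOp_conjS, Medium.mulG, l2Emb_mulL2 _ (M.temperate_G j k)]
  rw [HDot.l2Emb_grad, HDot.grad_apply]

/-- Green's formula `⟨H₀^{1/2} v, H₀^{1/2} u⟩ = ⟨v, H₀ u⟩`. -/
theorem HDot.inner_eq_inner_H0 {u v : HDot M} {v' w : L2 d} (hv : v.dist = l2Emb d v')
    (hw : M.H0 u.dist = l2Emb d w) : inner ℂ v u = inner ℂ v' w := by
  have : NeZero d := ⟨by have := hd.out; omega⟩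
  -- Here `v` lies in `L²` with gradient in `L²`, so one Schwartz sequence approximates it in `L²`
  -- and in `Ḣ¹` at once, and both sides pass to the limit.
  obtain ⟨φ, h1, h2⟩ := exists_schwartz_tendsto_H1 (v := v') (g := v.grad)
    (fun j => by rw [← hv, HDot.l2Emb_grad])
  have h3 : Tendsto (fun n => schwartzHDot M (φ n)) atTop (𝓝 v) :=
    HDot.tendsto_of_grad (by simpa only [schwartzHDot_grad] using h2)
  have h4 : Tendsto (fun n => inner ℂ (schwartzHDot M (φ n)) u) atTop (𝓝 (inner ℂ v u)) :=
    h3.inner tendsto_const_nhds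
  have h5 : Tendsto (fun n => inner ℂ ((φ n).toLp 2 : L2 d) w) atTop (𝓝 (inner ℂ v' w)) :=
    h1.inner tendsto_const_nhds
  refine tendsto_nhds_unique h4 (h5.congr fun n => ?_)
  rw [inner_schwartzHDot, hw, inner_schwartz_eq]

end Green

/-! ### The resolvent of the stationary equation -/

section Resolvent

open Filter Topology
open scoped Laplacian Real

/-! ### Elementary inequalities behind the coercivity. -/

section Arithmetic

theorem sum_sq_le_double {n : ℕ} (f : Fin n → Fin n → ℝ) :
    (∑ l, ∑ j, f l j) ^ 2 ≤ (n : ℝ) ^ 2 * ∑ l, ∑ j, f l j ^ 2 := by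
  rw [← Finset.sum_product', ← Finset.sum_product']
  simpa [sq] using sq_sum_le_card_mul_sum_sq (s := (Finset.univ ×ˢ Finset.univ :
    Finset (Fin n × Fin n))) (f := fun p => f p.1 p.2)

theorem add_sum_sq_le {n : ℕ} (a : ℝ) (f : Fin n → ℝ) :
    (a + ∑ k, f k) ^ 2 ≤ (n + 1 : ℝ) * (a ^ 2 + ∑ k, f k ^ 2) := by
  simpa [Fin.sum_univ_succ] using sq_sum_le_card_mul_sum_sq (s := Finset.univ)
    (f := Fin.cons a f)

/-- For the second order estimate: `H` stands for the second derivatives of `u`, `D` for its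
gradient, `B` for multiplication by `∂_l G_{jk}` and `A` for the zeroth order terms. Only one factor
is of second order, so the error can be absorbed. -/
theorem norm_commutator_le {n : ℕ} {E : Type*} [NormedAddCommGroup E] [InnerProductSpace ℂ E]
    (B : Fin n → Fin n → Fin n → E →L[ℂ] E) (A : E →L[ℂ] E) (H : Fin n → Fin n → E)
    (D : Fin n → E) (u₀ : E) :
    ‖∑ l, ∑ j, ∑ k, inner ℂ (H l j) (B l j k (D k)) + ∑ l, inner ℂ (H l l) (A u₀)‖ ≤
      (∑ l, ∑ j, ∑ k, ‖B l j k‖ + ‖A‖) * ((∑ l, ∑ j, ‖H l j‖) * (‖u₀‖ + ∑ k, ‖D k‖)) := by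
  obtain ⟨X, hX⟩ : ∃ X, X = ∑ l, ∑ j, ‖H l j‖ := ⟨_, rfl⟩
  obtain ⟨Y, hY⟩ : ∃ Y, Y = ‖u₀‖ + ∑ k, ‖D k‖ := ⟨_, rfl⟩
  rw [← hX, ← hY]
  have hHX : ∀ l j, ‖H l j‖ ≤ X := fun l j => by
    rw [hX]
    exact (Finset.single_le_sum (f := fun j => ‖H l j‖) (fun _ _ => norm_nonneg _)
      (Finset.mem_univ j)).trans (Finset.single_le_sum (f := fun l => ∑ j, ‖H l j‖)
        (fun _ _ => by positivity) (Finset.mem_univ l))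
  have hDY : ∀ k, ‖D k‖ ≤ Y := fun k => by
    rw [hY]
    exact (Finset.single_le_sum (f := fun k => ‖D k‖) (fun _ _ => norm_nonneg _)
      (Finset.mem_univ k)).trans (le_add_of_nonneg_left (norm_nonneg _))
  have huY : ‖u₀‖ ≤ Y := by
    rw [hY]
    exact le_add_of_nonneg_right (by positivity)
  have hX0 : 0 ≤ X := by rw [hX]; positivity
  rw [add_mul]
  refine (norm_add_le _ _).trans (add_le_add ?_ ?_)
  · rw [Finset.sum_mul]
    refine (norm_sum_le _ _).trans (Finset.sum_le_sum fun l _ => ?_)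
    rw [Finset.sum_mul]
    refine (norm_sum_le _ _).trans (Finset.sum_le_sum fun j _ => ?_)
    rw [Finset.sum_mul]
    refine (norm_sum_le _ _).trans (Finset.sum_le_sum fun k _ => ?_)
    refine (norm_inner_le_norm _ _).trans ?_
    calc ‖H l j‖ * ‖B l j k (D k)‖ ≤ X * (‖B l j k‖ * Y) :=
          mul_le_mul (hHX l j) (((B l j k).le_opNorm _).trans
            (mul_le_mul_of_nonneg_left (hDY k) (norm_nonneg _))) (norm_nonneg _) hX0
      _ = ‖B l j k‖ * (X * Y) := by ring
  · rw [← sum_inner]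
    refine (norm_inner_le_norm _ _).trans ?_
    have h1 : ‖∑ l, H l l‖ ≤ X := by
      rw [hX]
      exact (norm_sum_le _ _).trans (Finset.sum_le_sum fun l _ =>
        Finset.single_le_sum (f := fun j => ‖H l j‖) (fun _ _ => norm_nonneg _)
          (Finset.mem_univ l))
    calc _ ≤ X * (‖A‖ * Y) := mul_le_mul h1 ((A.le_opNorm u₀).trans
          (mul_le_mul_of_nonneg_left huY (norm_nonneg _))) (norm_nonneg _) hX0
      _ = ‖A‖ * (X * Y) := by ring

/-- The first and second order estimates together control `u - κ Δ u`. -/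
theorem exists_coercive_combination {n : ℕ} (hn : 0 < n) {y c₀ r C κ : ℝ} (hy : 0 < y)
    (hc0 : 0 < c₀) (hr : 0 < r) (hκ : 0 < κ) : ∃ ν c : ℝ, 0 ≤ ν ∧ 0 < c ∧
    ∀ (E : Type) [NormedAddCommGroup E] [InnerProductSpace ℂ E] (H : Fin n → Fin n → E)
      (D : Fin n → E) (u₀ f : E) (P Q : ℝ), f = u₀ - (κ : ℂ) • ∑ l, H l l →
      y * (c₀ * ∑ k, ‖D k‖ ^ 2) + y * r * ‖u₀‖ ^ 2 ≤ P →
      y * (c₀ * ∑ l, ∑ j, ‖H l j‖ ^ 2) -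
        C * ((∑ l, ∑ j, ‖H l j‖) * (‖u₀‖ + ∑ k, ‖D k‖)) ≤ Q →
      c * ‖f‖ ^ 2 ≤ (1 + ν) * P + κ * Q := by
  have hd0 : (0 : ℝ) < n := by exact_mod_cast hn
  -- Put `X = ∑ ‖H l j‖` and `Y = ‖u₀‖ + ∑ ‖D k‖`. The hypotheses give `P ≥ m Y² / (n + 1)` and `κ Q
  -- ≥ p X² - κ C X Y`. The cross term is at most `p/2 X² + (κC)²/(2p) Y²`; `q` is what pays for its
  -- `Y²` part and leaves `p/2 Y²`, and `ν` is chosen so that `ν P ≥ q Y²`. What remains, `p/2 (X² +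
  -- Y²)`, dominates `‖f‖²` because `‖f‖ ≤ (1 + κ)(X + Y)`.
  obtain ⟨m, hm⟩ : ∃ m, m = min (y * c₀) (y * r) := ⟨_, rfl⟩
  have hm0 : 0 < m := hm ▸ lt_min (by positivity) (by positivity)
  have hm1 : m ≤ y * c₀ := hm ▸ min_le_left _ _
  have hm2 : m ≤ y * r := hm ▸ min_le_right _ _
  obtain ⟨p, hp⟩ : ∃ p, p = κ * y * c₀ / n ^ 2 := ⟨_, rfl⟩
  have hp0 : 0 < p := by rw [hp]; positivity
  obtain ⟨q, hq⟩ : ∃ q, q = (κ * C) ^ 2 / (2 * p) + p / 2 := ⟨_, rfl⟩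
  have hq0 : 0 < q := by rw [hq]; positivity
  obtain ⟨ν, hν⟩ : ∃ ν, ν = (n + 1) / m * q := ⟨_, rfl⟩
  have hν0 : 0 < ν := by rw [hν]; positivity
  refine ⟨ν, p / (4 * (1 + κ) ^ 2), hν0.le, by positivity, fun E _ _ H D u₀ f P Q hf e1 e2 => ?_⟩
  have hX2 : (∑ l, ∑ j, ‖H l j‖) ^ 2 ≤ (n : ℝ) ^ 2 * ∑ l, ∑ j, ‖H l j‖ ^ 2 :=
    sum_sq_le_double fun l j => ‖H l j‖
  have hY2 : (‖u₀‖ + ∑ k, ‖D k‖) ^ 2 ≤ (n + 1 : ℝ) * (‖u₀‖ ^ 2 + ∑ k, ‖D k‖ ^ 2) :=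
    add_sum_sq_le _ _
  have h1 : ‖∑ l, H l l‖ ≤ ∑ l, ∑ j, ‖H l j‖ := (norm_sum_le _ _).trans
    (Finset.sum_le_sum fun l _ => Finset.single_le_sum (f := fun j => ‖H l j‖)
      (fun _ _ => norm_nonneg _) (Finset.mem_univ l))
  have h2 : ‖u₀‖ ≤ ‖u₀‖ + ∑ k, ‖D k‖ := le_add_of_nonneg_right (by positivity)
  have hX0 : 0 ≤ ∑ l, ∑ j, ‖H l j‖ := by positivity
  have hY0 : 0 ≤ ‖u₀‖ + ∑ k, ‖D k‖ := by positivity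
  have hS0 : 0 ≤ ‖u₀‖ ^ 2 := by positivity
  have hS1 : 0 ≤ ∑ k, ‖D k‖ ^ 2 := by positivity
  generalize (∑ l, ∑ j, ‖H l j‖) = X at *
  generalize (‖u₀‖ + ∑ k, ‖D k‖) = Y at *
  generalize (∑ l, ∑ j, ‖H l j‖ ^ 2) = S2 at *
  generalize (∑ k, ‖D k‖ ^ 2) = S1 at *
  have hfn : ‖f‖ ≤ (1 + κ) * (X + Y) := by
    rw [hf]
    refine (norm_sub_le _ _).trans ?_
    rw [norm_smul, Complex.norm_real, Real.norm_of_nonneg hκ.le]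
    have h3 := mul_le_mul_of_nonneg_left h1 hκ.le
    have h4 := mul_nonneg hκ.le hY0
    calc _ ≤ Y + κ * X := add_le_add h2 h3
      _ ≤ (1 + κ) * (X + Y) := by linarith
  generalize ‖u₀‖ ^ 2 = S0 at *
  have g1 : m / (n + 1) * Y ^ 2 ≤ P := by
    refine le_trans ?_ e1
    calc m / (n + 1) * Y ^ 2 ≤ m / (n + 1) * ((n + 1 : ℝ) * (S0 + S1)) := by gcongr
      _ = m * S1 + m * S0 := by field_simp; ring
      _ ≤ y * c₀ * S1 + y * r * S0 := by gcongr
      _ = _ := by ring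
  have g2 : p * X ^ 2 ≤ κ * (y * (c₀ * S2)) := by
    calc p * X ^ 2 ≤ p * ((n : ℝ) ^ 2 * S2) := by gcongr
      _ = _ := by rw [hp]; field_simp
  have g3 : (1 + ν) * (m / (n + 1) * Y ^ 2) ≥ q * Y ^ 2 := by
    have h1 : ν * (m / (n + 1) * Y ^ 2) = q * Y ^ 2 := by rw [hν]; field_simp
    have h2 : 0 ≤ m / (n + 1) * Y ^ 2 := by positivity
    rw [add_mul, h1]
    linarith
  have g4 : κ * C * (X * Y) ≤ p / 2 * X ^ 2 + (κ * C) ^ 2 / (2 * p) * Y ^ 2 := by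
    have h1 : p / 2 * X ^ 2 + (κ * C) ^ 2 / (2 * p) * Y ^ 2 - κ * C * (X * Y) =
        (p * X - κ * C * Y) ^ 2 / (2 * p) := by field_simp; ring
    have h2 : 0 ≤ (p * X - κ * C * Y) ^ 2 / (2 * p) := by positivity
    linarith
  have g5 := mul_le_mul_of_nonneg_left e2 hκ.le
  have g6 := mul_le_mul_of_nonneg_left g1 (by positivity : (0 : ℝ) ≤ 1 + ν)
  have g7 : p / (4 * (1 + κ) ^ 2) * ‖f‖ ^ 2 ≤ p / 4 * (X + Y) ^ 2 := by
    calc _ ≤ p / (4 * (1 + κ) ^ 2) * ((1 + κ) * (X + Y)) ^ 2 := by gcongr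
      _ = _ := by field_simp
  have g8 : p / 4 * (X + Y) ^ 2 ≤ p / 2 * X ^ 2 + p / 2 * Y ^ 2 := by
    have h1 : 0 ≤ p / 4 * (X - Y) ^ 2 := by positivity
    linarith
  have g9 : q * Y ^ 2 = (κ * C) ^ 2 / (2 * p) * Y ^ 2 + p / 2 * Y ^ 2 := by rw [hq]; ring
  linarith

end Arithmetic

/-! ### The Bessel potential, the stationary operator on `L²`, and commutators. -/

section Operators

variable {d : ℕ}

theorem l2Emb_schwartzL2 (φ : 𝓢(Space d, ℂ)) : l2Emb d (schwartzL2 d φ) = (φ : 𝓢'(Space d, ℂ)) :=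
  l2Emb_toLp φ

theorem inner_schwartzL2 (φ : 𝓢(Space d, ℂ)) (h : L2 d) :
    inner ℂ (schwartzL2 d φ) h = l2Emb d h (conjS φ) :=
  inner_schwartz_eq φ h

/-- A continuous operator on the tempered distributions which preserves `L²` is bounded on `L²`. -/
theorem exists_clm_of_preserves_L2 (Φ : 𝓢'(Space d, ℂ) →L[ℂ] 𝓢'(Space d, ℂ))
    (h : ∀ f : L2 d, Φ (l2Emb d f) ∈ LinearMap.range (l2Emb d)) :
    ∃ B : L2 d →L[ℂ] L2 d, ∀ f, l2Emb d (B f) = Φ (l2Emb d f) := by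
  let B : L2 d →ₗ[ℂ] L2 d := l2Rep d ∘ₗ
    LinearMap.codRestrict (LinearMap.range (l2Emb d)) (Φ.toLinearMap ∘ₗ l2Emb d) h
  have hB : ∀ f, l2Emb d (B f) = Φ (l2Emb d f) := fun f => l2Emb_l2Rep _
  have hc : Continuous B := by
    refine LinearMap.continuous_of_seq_closed_graph B fun u x y hu hy => l2Emb_injective d ?_
    have h1 := (continuous_l2Emb.tendsto y).comp hy
    have h2 := ((Φ.continuous.comp continuous_l2Emb).tendsto x).comp hu
    rw [hB]
    exact tendsto_nhds_unique h1 (h2.congr fun n => (hB (u n)).symm)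
  exact ⟨⟨B, hc⟩, hB⟩

theorem mem_range_of_memSobolev {s : ℝ} (hs : 0 ≤ s) {T : 𝓢'(Space d, ℂ)}
    (h : MemSobolev s 2 T) : T ∈ LinearMap.range (l2Emb d) := by
  obtain ⟨f, hf⟩ := memSobolev_zero_iff.mp (h.mono hs)
  exact ⟨f, hf.symm⟩

variable (M : Medium d)

/-- `H₀` maps `H²` to `L²`. -/
theorem Medium.H0_mem_range {T : 𝓢'(Space d, ℂ)} (h : MemSobolev 2 2 T) :
    M.H0 T ∈ LinearMap.range (l2Emb d) := by
  rw [M.H0_eq]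
  refine neg_mem (sum_mem fun j _ => sum_mem fun k _ => ?_)
  rw [lineDerivOp_smulLeft (M.temperate_G j k)]
  obtain ⟨f, hf⟩ := mem_range_of_memSobolev (by norm_num) (h.lineDerivOp (m := basisVec k))
  obtain ⟨g, hg⟩ := mem_range_of_memSobolev (by norm_num)
    ((h.lineDerivOp (m := basisVec k)).lineDerivOp (m := basisVec j))
  refine add_mem ⟨M.mulDG j j k f, ?_⟩ ⟨M.mulG j k g, ?_⟩
  · rw [Medium.mulDG, l2Emb_mulL2 _ (M.temperate_dG j j k), hf]
    rfl
  · rw [Medium.mulG, l2Emb_mulL2 _ (M.temperate_G j k), hg]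

theorem memSobolev_bessel (f : L2 d) :
    MemSobolev 2 2 (besselPotential (Space d) ℂ (-2) (l2Emb d f)) := by
  rw [memSobolev_besselPotential_iff, show (-2 : ℝ) + 2 = 0 by norm_num]
  exact memSobolev_zero_iff.mpr ⟨f, rfl⟩

theorem exists_besselL2 (d : ℕ) : ∃ J : L2 d →L[ℂ] L2 d, ∀ f,
    l2Emb d (J f) = besselPotential (Space d) ℂ (-2) (l2Emb d f) :=
  exists_clm_of_preserves_L2 _ fun f => mem_range_of_memSobolev (by norm_num) (memSobolev_bessel f)

/-- The operator `(1 - (2π)⁻² Δ)⁻¹` on `L²`. -/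
def besselL2 (d : ℕ) : L2 d →L[ℂ] L2 d := (exists_besselL2 d).choose

theorem l2Emb_besselL2 (f : L2 d) :
    l2Emb d (besselL2 d f) = besselPotential (Space d) ℂ (-2) (l2Emb d f) :=
  (exists_besselL2 d).choose_spec f

theorem Medium.exists_H0Bessel : ∃ B : L2 d →L[ℂ] L2 d, ∀ f,
    l2Emb d (B f) = M.H0 (besselPotential (Space d) ℂ (-2) (l2Emb d f)) :=
  exists_clm_of_preserves_L2 (M.H0 ∘L besselPotential (Space d) ℂ (-2)) fun f =>
    M.H0_mem_range (memSobolev_bessel f)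

/-- The operator `H₀ (1 - (2π)⁻² Δ)⁻¹` on `L²`. -/
def Medium.H0Bessel : L2 d →L[ℂ] L2 d := M.exists_H0Bessel.choose

theorem Medium.l2Emb_H0Bessel (f : L2 d) :
    l2Emb d (M.H0Bessel f) = M.H0 (l2Emb d (besselL2 d f)) := by
  rw [l2Emb_besselL2]
  exact M.exists_H0Bessel.choose_spec f

/-- The operator `(H₀ - i z a - z²) (1 - (2π)⁻² Δ)⁻¹` on `L²`. -/
def Medium.stationary (z : ℂ) : L2 d →L[ℂ] L2 d :=
  M.H0Bessel - ((Complex.I * z) • M.mulA ∘L besselL2 d + z ^ 2 • besselL2 d)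

theorem Medium.stationary_apply (z : ℂ) (f : L2 d) : M.stationary z f =
    M.H0Bessel f - ((Complex.I * z) • M.mulA (besselL2 d f) + z ^ 2 • besselL2 d f) := rfl

theorem Medium.l2Emb_stationary (z : ℂ) (f : L2 d) : l2Emb d (M.stationary z f) =
    M.H0 (l2Emb d (besselL2 d f)) -
      l2Emb d ((Complex.I * z) • M.mulA (besselL2 d f) + z ^ 2 • besselL2 d f) := by
  rw [M.stationary_apply, map_sub, M.l2Emb_H0Bessel]

theorem bessel_two_eq (T : 𝓢'(Space d, ℂ)) :
    besselPotential (Space d) ℂ 2 T = T - ((((2 * π) ^ 2)⁻¹ : ℝ) : ℂ) • Δ T := by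
  rw [← fourierMultiplier_affine, besselPotential]
  congr 2
  ext x
  rw [mul_inv_cancel₀ (by positivity)]
  norm_num

/-- `(1 - (2π)⁻² Δ)⁻¹` preserves the Schwartz functions. -/
theorem exists_schwartz_bessel (f : 𝓢(Space d, ℂ)) : ∃ u : 𝓢(Space d, ℂ),
    besselL2 d (schwartzL2 d f) = schwartzL2 d u ∧
    (schwartzL2 d f) = schwartzL2 d u - ((((2 * π) ^ 2)⁻¹ : ℝ) : ℂ) •
      ∑ l : Fin d, schwartzL2 d (∂_{basisVec l} (∂_{basisVec l} u)) := by
  let u : 𝓢(Space d, ℂ) := SchwartzMap.fourierMultiplierCLM ℂ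
    (fun x : Space d => (((1 + ‖x‖ ^ 2) ^ ((-2 : ℝ) / 2) : ℝ) : ℂ)) f
  have hu : besselPotential (Space d) ℂ (-2) (f : 𝓢'(Space d, ℂ)) = (u : 𝓢'(Space d, ℂ)) :=
    fourierMultiplierCLM_toTemperedDistributionCLM_eq (by fun_prop) f
  refine ⟨u, l2Emb_injective d ?_, l2Emb_injective d ?_⟩
  · rw [l2Emb_besselL2, l2Emb_schwartzL2, l2Emb_schwartzL2, hu]
  · rw [besselPotential_neg_apply_eq_iff, bessel_two_eq, laplacian_eq_sum_basisVec] at hu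
    rw [map_sub, map_smul, map_sum]
    simp only [l2Emb_schwartzL2]
    rw [← hu]
    simp only [lineDerivOp_toTemperedDistributionCLM_eq]

/-- Integration by parts. -/
theorem inner_lineDeriv_eq (m : Space d) (φ : 𝓢(Space d, ℂ)) (g : L2 d) :
    inner ℂ (schwartzL2 d (∂_{m} φ)) g = -(∂_{m} (l2Emb d g)) (conjS φ) := by
  rw [inner_schwartzL2, ← lineDerivOp_conjS, TemperedDistribution.lineDerivOp_apply_apply,
    map_neg, neg_neg]

/-- For Schwartz `f = u - κΔu` with `κ = (2π)⁻²`, the inner product is `‖u‖² + κ‖∇u‖²`; density does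
the rest. It makes `1 + νJ` invertible for `ν ≥ 0`. -/
theorem re_inner_bessel_nonneg (f : L2 d) : 0 ≤ (inner ℂ f (besselL2 d f)).re := by
  obtain ⟨φ, hφ⟩ := schwartzL2_dense f
  have hc : Continuous fun f : L2 d => (inner ℂ f (besselL2 d f)).re :=
    Complex.continuous_re.comp (continuous_id.inner (besselL2 d).continuous)
  refine ge_of_tendsto' ((hc.tendsto f).comp hφ) fun n => ?_
  obtain ⟨u, h1, h2⟩ := exists_schwartz_bessel (φ n)
  have h3 : ∀ l : Fin d, inner ℂ (schwartzL2 d (∂_{basisVec l} (∂_{basisVec l} u))) (schwartzL2 d u) =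
      -((‖(schwartzL2 d (∂_{basisVec l} u))‖ ^ 2 : ℝ) : ℂ) := by
    intro l
    rw [inner_lineDeriv_eq, l2Emb_schwartzL2, lineDerivOp_toTemperedDistributionCLM_eq, ← l2Emb_schwartzL2,
      ← inner_schwartzL2, inner_self_eq_norm_sq_to_K]
    simp
  change 0 ≤ (inner ℂ (schwartzL2 d (φ n)) (besselL2 d (schwartzL2 d (φ n)))).re
  rw [h1, h2, inner_sub_left, inner_smul_left, sum_inner, inner_self_eq_norm_sq_to_K]
  simp only [h3]
  rw [Complex.conj_ofReal, Finset.sum_neg_distrib, mul_neg, sub_neg_eq_add, ← Complex.ofReal_sum,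
    ← Complex.ofReal_mul]
  change 0 ≤ (((_ : ℝ) : ℂ) ^ 2 + _).re
  rw [← Complex.ofReal_pow, ← Complex.ofReal_add, Complex.ofReal_re]
  positivity

/-- The commutator of `∂_l` with `H₀` has the same divergence form, with `∂_l G_{jk}` in place of
`G_{jk}`. After one integration by parts it pairs second derivatives with first ones only. -/
theorem Medium.lineDerivOp_H0 (l : Fin d) (T : 𝓢'(Space d, ℂ)) :
    ∂_{basisVec l} (M.H0 T) = M.H0 (∂_{basisVec l} T) -
      ∑ j, ∑ k, ∂_{basisVec j} (TemperedDistribution.smulLeftCLM ℂ (M.dG l j k)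
        (∂_{basisVec k} T)) := by
  rw [M.H0_eq, M.H0_eq, lineDerivOp_neg, lineDerivOp_sum, neg_sub_left, neg_inj,
    ← Finset.sum_add_distrib]
  refine Finset.sum_congr rfl fun j _ => ?_
  rw [lineDerivOp_sum, ← Finset.sum_add_distrib]
  refine Finset.sum_congr rfl fun k _ => ?_
  rw [lineDerivOp_comm, lineDerivOp_smulLeft (M.temperate_G j k), lineDerivOp_add,
    lineDerivOp_comm (basisVec l) (basisVec k)]
  rfl

theorem Medium.inner_mulA (u : L2 d) : ∃ a₀ : ℝ, 0 ≤ a₀ ∧ inner ℂ u (M.mulA u) = (a₀ : ℂ) := by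
  refine ⟨∫ x, M.a x * Complex.normSq (u x), integral_nonneg fun x =>
    mul_nonneg (M.a_nonneg x) (Complex.normSq_nonneg _), ?_⟩
  rw [L2.inner_def]
  refine Eq.trans (integral_congr_ae ?_) integral_ofReal
  filter_upwards [mulL2_coeFn _ M.memLp_a u] with x hx
  rw [Medium.mulA, hx, RCLike.inner_apply, mul_assoc, Complex.mul_conj]
  push_cast
  rfl

/-- The reason for the multiplier `i z̄`: when `Im z > 0` it turns the energy, damping and mass
terms into nonnegative quantities simultaneously, whatever `Re z` is. -/
theorem re_omega_mul {z : ℂ} {A a₀ N : ℝ} :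
    ((Complex.I * star z) * (A - (Complex.I * z * a₀ + z ^ 2 * N))).re =
      z.im * A + ‖z‖ ^ 2 * a₀ + z.im * ‖z‖ ^ 2 * N := by
  rw [Complex.sq_norm, Complex.normSq_apply]
  simp [sq]
  ring

end Operators

/-! ### A priori estimates, Lax–Milgram and the existence of `R(z)`. -/

section Coercivity

variable {d : ℕ} [hd : Fact (3 ≤ d)] (M : Medium d)

/-- The principal term of the second order estimate. -/
theorem Medium.neg_inner_second_deriv (u : 𝓢(Space d, ℂ)) {h : L2 d}
    (hh : M.H0 (u : 𝓢'(Space d, ℂ)) = l2Emb d h) (l : Fin d) :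
    -inner ℂ (schwartzL2 d (∂_{basisVec l} (∂_{basisVec l} u))) h =
      ((‖schwartzHDot M (∂_{basisVec l} u)‖ ^ 2 : ℝ) : ℂ) +
        ∑ j, ∑ k, inner ℂ (schwartzL2 d (∂_{basisVec j} (∂_{basisVec l} u)))
          (M.mulDG l j k (schwartzL2 d (∂_{basisVec k} u))) := by
  rw [inner_lineDeriv_eq, neg_neg, ← hh, M.lineDerivOp_H0, sub_apply, sum_apply,
    lineDerivOp_toTemperedDistributionCLM_eq, ← schwartzHDot_dist (M := M), ← inner_schwartzHDot,
    inner_self_eq_norm_sq_to_K, sub_eq_add_neg, ← Finset.sum_neg_distrib]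
  congr 1
  · simp
  · refine Finset.sum_congr rfl fun j _ => ?_
    rw [sum_apply, ← Finset.sum_neg_distrib]
    refine Finset.sum_congr rfl fun k _ => ?_
    rw [inner_lineDeriv_eq, Medium.mulDG, l2Emb_mulL2 _ (M.temperate_dG l j k), l2Emb_schwartzL2,
      lineDerivOp_toTemperedDistributionCLM_eq]

/-- The first order estimate. -/
theorem Medium.first_order_estimate {c z} (hz : 0 < z.im)
    (hc : ∀ x (v : Fin d → ℝ), c * ∑ j, v j ^ 2 ≤ v ⬝ᵥ (M.G x).mulVec v)
    (u : 𝓢(Space d, ℂ)) {h : L2 d} (hh : M.H0 (u : 𝓢'(Space d, ℂ)) = l2Emb d h) :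
    z.im * (c * ∑ k : Fin d, ‖schwartzL2 d (∂_{basisVec k} u)‖ ^ 2) +
      z.im * ‖z‖ ^ 2 * ‖(schwartzL2 d u)‖ ^ 2 ≤
    ((Complex.I * star z) * inner ℂ (schwartzL2 d u)
      (h - ((Complex.I * z) • M.mulA (schwartzL2 d u) + z ^ 2 • (schwartzL2 d u)))).re := by
  obtain ⟨a₀, ha0, ha⟩ := M.inner_mulA (schwartzL2 d u)
  have h1 : inner ℂ (schwartzL2 d u) h = ((‖schwartzHDot M u‖ ^ 2 : ℝ) : ℂ) := by
    rw [inner_schwartzL2, ← hh, ← schwartzHDot_dist (M := M), ← inner_schwartzHDot,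
      inner_self_eq_norm_sq_to_K]
    simp
  have h2 : inner ℂ (schwartzL2 d u) (schwartzL2 d u) = ((‖(schwartzL2 d u)‖ ^ 2 : ℝ) : ℂ) := by
    rw [inner_self_eq_norm_sq_to_K]
    simp
  rw [inner_sub_right, inner_add_right, inner_smul_right, inner_smul_right, ha, h1, h2,
    re_omega_mul]
  have h3 : c * ∑ k : Fin d, ‖schwartzL2 d (∂_{basisVec k} u)‖ ^ 2 ≤ ‖schwartzHDot M u‖ ^ 2 := by
    rw [HDot.norm_sq_eq, schwartzHDot_grad]
    exact M.le_re_inner_sum hc fun k => schwartzL2 d (∂_{basisVec k} u)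
  have h4 : 0 ≤ ‖z‖ ^ 2 * a₀ := by positivity
  have h5 := mul_le_mul_of_nonneg_left h3 hz.le
  linarith

/-- The second order estimate. -/
theorem Medium.second_order_estimate {z : ℂ} (hz : 0 < z.im) {c : ℝ}
    (hc : ∀ x (v : Fin d → ℝ), c * ∑ j, v j ^ 2 ≤ v ⬝ᵥ (M.G x).mulVec v) :
    ∃ C : ℝ, 0 ≤ C ∧ ∀ (u : 𝓢(Space d, ℂ)) (h : L2 d),
    M.H0 (u : 𝓢'(Space d, ℂ)) = l2Emb d h →
    z.im * (c * ∑ l : Fin d, ∑ j : Fin d,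
        ‖(schwartzL2 d (∂_{basisVec j} (∂_{basisVec l} u)))‖ ^ 2) -
      C * ((∑ l : Fin d, ∑ j : Fin d, ‖(schwartzL2 d (∂_{basisVec j} (∂_{basisVec l} u)))‖) *
        (‖(schwartzL2 d u)‖ + ∑ k : Fin d, ‖schwartzL2 d (∂_{basisVec k} u)‖)) ≤
    ((Complex.I * star z) * -∑ l : Fin d, inner ℂ
      (schwartzL2 d (∂_{basisVec l} (∂_{basisVec l} u)))
      (h - ((Complex.I * z) • M.mulA (schwartzL2 d u) + z ^ 2 • (schwartzL2 d u)))).re := by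
  obtain ⟨K, hK⟩ : ∃ K, K = ∑ l, ∑ j, ∑ k, ‖M.mulDG l j k‖ +
      ‖(Complex.I * z) • M.mulA + z ^ 2 • ContinuousLinearMap.id ℂ (L2 d)‖ := ⟨_, rfl⟩
  have hK0 : 0 ≤ K := by rw [hK]; positivity
  refine ⟨‖z‖ * K, mul_nonneg (norm_nonneg _) hK0, fun u h hh => ?_⟩
  have hcomm := norm_commutator_le M.mulDG
    ((Complex.I * z) • M.mulA + z ^ 2 • ContinuousLinearMap.id ℂ (L2 d))
    (fun l j => schwartzL2 d (∂_{basisVec j} (∂_{basisVec l} u)))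
    (fun k => schwartzL2 d (∂_{basisVec k} u)) (schwartzL2 d u)
  rw [← hK] at hcomm
  have hmain : -∑ l : Fin d, inner ℂ (schwartzL2 d (∂_{basisVec l} (∂_{basisVec l} u)))
        (h - ((Complex.I * z) • M.mulA (schwartzL2 d u) + z ^ 2 • schwartzL2 d u)) =
      ((∑ l : Fin d, ‖schwartzHDot M (∂_{basisVec l} u)‖ ^ 2 : ℝ) : ℂ) +
        (∑ l : Fin d, ∑ j : Fin d, ∑ k : Fin d,
          inner ℂ (schwartzL2 d (∂_{basisVec j} (∂_{basisVec l} u)))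
            (M.mulDG l j k (schwartzL2 d (∂_{basisVec k} u))) +
          ∑ l : Fin d, inner ℂ (schwartzL2 d (∂_{basisVec l} (∂_{basisVec l} u)))
            (((Complex.I * z) • M.mulA + z ^ 2 • ContinuousLinearMap.id ℂ (L2 d))
              (schwartzL2 d u))) := by
    rw [Complex.ofReal_sum, ← add_assoc, ← Finset.sum_add_distrib, ← Finset.sum_add_distrib,
      ← Finset.sum_neg_distrib]
    refine Finset.sum_congr rfl fun l _ => ?_
    rw [inner_sub_right, neg_sub, sub_eq_neg_add, M.neg_inner_second_deriv u hh l]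
    rfl
  have hprinc : c * ∑ l : Fin d, ∑ j : Fin d,
      ‖schwartzL2 d (∂_{basisVec j} (∂_{basisVec l} u))‖ ^ 2 ≤
        ∑ l : Fin d, ‖schwartzHDot M (∂_{basisVec l} u)‖ ^ 2 := by
    rw [Finset.mul_sum]
    refine Finset.sum_le_sum fun l _ => ?_
    rw [HDot.norm_sq_eq, schwartzHDot_grad]
    exact M.le_re_inner_sum hc fun j => schwartzL2 d (∂_{basisVec j} (∂_{basisVec l} u))
  rw [hmain, mul_add (Complex.I * star z), Complex.add_re]
  -- `Re (i z̄) = Im z` keeps the principal term positive; on the remainder only `|i z̄| = ‖z‖` is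
  -- used.
  have h1 : ∀ r : ℝ, ((Complex.I * star z) * (r : ℂ)).re = z.im * r := by
    intro r
    rw [Complex.re_mul_ofReal]
    simp
  have h2 : ∀ (w : ℂ) (b : ℝ), ‖w‖ ≤ K * b →
      -(‖z‖ * K * b) ≤ ((Complex.I * star z) * w).re := by
    intro w b hw
    have h3 := (abs_le.mp (Complex.abs_re_le_norm ((Complex.I * star z) * w))).1
    have h4 : ‖(Complex.I * star z) * w‖ = ‖z‖ * ‖w‖ := by simp
    rw [h4] at h3
    have h5 := mul_le_mul_of_nonneg_left hw (norm_nonneg z)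
    linarith
  rw [h1, sub_eq_add_neg]
  exact add_le_add (mul_le_mul_of_nonneg_left hprinc hz.le) (h2 _ _ hcomm)

/-- With `u = J f` and `κ = (2π)⁻²`, the test function is `f + νu = (1 + ν)u - κΔu`, so the form is
`(1 + ν)` times the first order one plus `κ` times the second order one. -/
theorem Medium.exists_coercive_schwartz {z : ℂ} (hz : 0 < z.im) : ∃ ν c : ℝ, 0 ≤ ν ∧ 0 < c ∧
    ∀ f : 𝓢(Space d, ℂ), c * ‖schwartzL2 d f‖ ^ 2 ≤
      ((Complex.I * star z) * inner ℂ (schwartzL2 d f + (ν : ℂ) • besselL2 d (schwartzL2 d f))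
        (M.stationary z (schwartzL2 d f))).re := by
  obtain ⟨c₀, hc0, hc⟩ := M.exists_elliptic
  obtain ⟨C, hC0, hC⟩ := M.second_order_estimate hz hc
  have hz0 : 0 < ‖z‖ := norm_pos_iff.mpr (by rintro rfl; simp at hz)
  have hκ0 : 0 < ((2 * π) ^ 2)⁻¹ := by positivity
  obtain ⟨ν, c, hν, hcp, hcomb⟩ := exists_coercive_combination (n := d) (C := C)
    (by have := hd.out; omega) hz hc0 (pow_pos hz0 2) hκ0
  refine ⟨ν, c, hν, hcp, fun f => ?_⟩
  obtain ⟨u, hJ, hf⟩ := exists_schwartz_bessel f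
  have hh : M.H0 (u : 𝓢'(Space d, ℂ)) = l2Emb d (M.H0Bessel (schwartzL2 d f)) := by
    rw [M.l2Emb_H0Bessel, hJ, l2Emb_schwartzL2]
  refine (hcomb (L2 d) (fun l j => schwartzL2 d (∂_{basisVec j} (∂_{basisVec l} u)))
    (fun k => schwartzL2 d (∂_{basisVec k} u)) (schwartzL2 d u) (schwartzL2 d f) _ _ hf
    (M.first_order_estimate hz hc u hh) (hC u _ hh)).trans_eq ?_
  rw [M.stationary_apply, hJ]
  generalize M.H0Bessel (schwartzL2 d f) -
    ((Complex.I * z) • M.mulA (schwartzL2 d u) + z ^ 2 • schwartzL2 d u) = w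
  rw [← Complex.re_ofReal_mul, ← Complex.re_ofReal_mul, ← Complex.add_re, hf, inner_add_left,
    inner_sub_left, inner_smul_left, inner_smul_left, sum_inner, Complex.conj_ofReal,
    Complex.conj_ofReal]
  congr 1
  push_cast
  ring

theorem Medium.isUnit_stationary {z : ℂ} (hz : 0 < z.im) : IsUnit (M.stationary z) := by
  obtain ⟨ν, c, hν, hc0, hc⟩ := M.exists_coercive_schwartz hz
  set S : L2 d →L[ℂ] L2 d := ContinuousLinearMap.id ℂ (L2 d) + (ν : ℂ) • besselL2 d with hS
  have hcoer : ∀ f : L2 d, c * ‖f‖ ^ 2 ≤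
      ((Complex.I * star z) * inner ℂ (S f) (M.stationary z f)).re := by
    intro f
    obtain ⟨φ, hφ⟩ := schwartzL2_dense f
    have h1 : Continuous fun f : L2 d => c * ‖f‖ ^ 2 := by fun_prop
    have h2 : Continuous fun f : L2 d =>
        ((Complex.I * star z) * inner ℂ (S f) (M.stationary z f)).re :=
      Complex.continuous_re.comp (continuous_const.mul
        (S.continuous.inner (M.stationary z).continuous))
    exact le_of_tendsto_of_tendsto' ((h1.tendsto f).comp hφ) ((h2.tendsto f).comp hφ)
      fun n => hc (φ n)
  have hSunit : IsUnit S := by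
    refine ContinuousLinearMap.isUnit_of_forall_le_norm_inner_map S (c := 1) one_pos fun f => ?_
    rw [NNReal.coe_one, mul_one, norm_inner_symm]
    refine le_trans ?_ (Complex.re_le_norm _)
    have h1 : inner ℂ f (S f) = inner ℂ f f + (ν : ℂ) * inner ℂ f (besselL2 d f) := by
      rw [← inner_smul_right, ← inner_add_right]
      rfl
    rw [h1, Complex.add_re, Complex.re_ofReal_mul]
    have h2 : (inner ℂ f f).re = ‖f‖ ^ 2 := (norm_sq_eq_re_inner (𝕜 := ℂ) f).symm
    have h3 := mul_nonneg hν (re_inner_bessel_nonneg f)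
    linarith
  have hz0 : 0 < ‖z‖ := norm_pos_iff.mpr (by rintro rfl; simp at hz)
  -- The coercive form is that of `S* P`, not of `P`; the invertible factor `S*` is cancelled at the
  -- end.
  have hB : IsUnit (star S * M.stationary z) := by
    refine ContinuousLinearMap.isUnit_of_forall_le_norm_inner_map _ (c := (c / ‖z‖).toNNReal)
      (Real.toNNReal_pos.mpr (div_pos hc0 hz0)) fun f => ?_
    have h1 := (hcoer f).trans (Complex.re_le_norm _)
    have h2 : inner ℂ f ((star S * M.stationary z) f) = inner ℂ (S f) (M.stationary z f) :=
      ContinuousLinearMap.adjoint_inner_right S f _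
    rw [norm_inner_symm, h2]
    have h3 : ‖(Complex.I * star z) * inner ℂ (S f) (M.stationary z f)‖ =
        ‖z‖ * ‖inner ℂ (S f) (M.stationary z f)‖ := by simp
    rw [h3] at h1
    rw [Real.coe_toNNReal _ (div_pos hc0 hz0).le, mul_div_assoc', div_le_iff₀ hz0]
    linarith
  obtain ⟨v, hv⟩ := hSunit.star
  rw [← hv] at hB
  exact (Units.isUnit_units_mul v _).mp hB

theorem Medium.exists_isInverse {z : ℂ} (hz : 0 < z.im) :
    ∃ R : L2 d →L[ℂ] L2 d, M.IsInverse z R := by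
  obtain ⟨T, hT⟩ := M.isUnit_stationary hz
  have hTl : ∀ f, (T⁻¹ : (L2 d →L[ℂ] L2 d)ˣ).val (M.stationary z f) = f := fun f => by
    have := congrArg (fun A : L2 d →L[ℂ] L2 d => A f) T.inv_mul
    rwa [hT] at this
  have hTr : ∀ f, M.stationary z ((T⁻¹ : (L2 d →L[ℂ] L2 d)ˣ).val f) = f := fun f => by
    have := congrArg (fun A : L2 d →L[ℂ] L2 d => A f) T.mul_inv
    rwa [hT] at this
  refine ⟨besselL2 d ∘L (T⁻¹ : (L2 d →L[ℂ] L2 d)ˣ).val, fun f u => ⟨?_, ?_⟩⟩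
  · rintro rfl
    refine ⟨?_, ?_⟩
    · have h := memSobolev_bessel ((T⁻¹ : (L2 d →L[ℂ] L2 d)ˣ).val f)
      rwa [← l2Emb_besselL2] at h
    · exact (M.l2Emb_stationary z _).symm.trans (congrArg (l2Emb d) (hTr f))
  -- Every `u` in `H²` is `J h` for some `h` in `L²`, so the equation for `u` becomes `P h = f` and
  -- uniqueness follows from injectivity of `P`.
  · rintro ⟨⟨h, hh⟩, hf⟩
    have hu : besselL2 d h = u := by
      apply l2Emb_injective d
      rw [l2Emb_besselL2, besselPotential_neg_apply_eq_iff]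
      exact hh
    have h1 : M.stationary z h = f := by
      apply l2Emb_injective d
      rw [M.l2Emb_stationary, hu]
      exact hf
    rw [ContinuousLinearMap.comp_apply, ← h1, hTl, hu]

theorem Medium.isInverse_R {z : ℂ} (hz : 0 < z.im) : M.IsInverse z (M.R z) := by
  have h := M.exists_isInverse hz
  rw [Medium.R, dif_pos h]
  exact h.choose_spec

end Coercivity

end Resolvent

/-! ### The wave generator -/

section Generator

open Filter Topology

variable {d : ℕ} [hd : Fact (3 ≤ d)] {M : Medium d}

theorem Energy.ext' {U W : Energy M} (h1 : U.fst.dist = W.fst.dist) (h2 : U.snd = W.snd) : U = W :=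
  WithLp.ofLp_injective 2 (Prod.ext (HDot.dist_injective h1) h2)

theorem DomA.incl_injective : Function.Injective (DomA.incl : DomA M →ₗ[ℂ] Energy M) :=
  Subtype.val_injective

theorem DomA.gen_fst_dist (U : DomA M) : U.gen.fst.dist = l2Emb d U.incl.snd := rfl

theorem DomA.gen_snd (U : DomA M) : U.gen.snd = U.h0 - Complex.I • M.mulA U.incl.snd := rfl

theorem DomA.l2Emb_gen_snd (U : DomA M) :
    l2Emb d U.gen.snd = M.H0 U.incl.fst.dist - l2Emb d (Complex.I • M.mulA U.incl.snd) :=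
  waveGen_snd M U

/-- By Green's formula the two off-diagonal terms `⟨v, u⟩` in `Ḣ¹` and `⟨H₀u, v⟩` in `L²` are
conjugate to each other, so their sum is real. Only the damping contributes, with the sign of `-a`.
-/
theorem DomA.dissipative (U : DomA M) : (inner ℂ U.incl U.gen).im ≤ 0 := by
  obtain ⟨a₀, ha0, ha⟩ := M.inner_mulA U.incl.snd
  have h1 : inner ℂ U.gen.fst U.incl.fst = inner ℂ U.incl.snd U.h0 :=
    HDot.inner_eq_inner_H0 U.gen_fst_dist U.h0_spec.symm
  have h2 : inner ℂ U.incl.fst U.gen.fst = starRingEnd ℂ (inner ℂ U.incl.snd U.h0) := by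
    rw [← h1, inner_conj_symm]
  have h3 : inner ℂ U.incl U.gen = inner ℂ U.incl.fst U.gen.fst + inner ℂ U.incl.snd U.gen.snd :=
    rfl
  rw [h3, h2, U.gen_snd, inner_sub_right, inner_smul_right, ha]
  generalize inner ℂ U.incl.snd U.h0 = α
  simp only [Complex.add_im, Complex.sub_im, Complex.conj_im, Complex.I_mul_im,
    Complex.ofReal_re]
  linarith

theorem isDissipative_waveGen (M : Medium d) : IsDissipative (waveGen M) :=
  fun U => DomA.dissipative (M := M) U

theorem DomA.im_mul_norm_incl_le (z : ℂ) (U : DomA M) :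
    z.im * ‖U.incl‖ ≤ ‖U.gen - z • U.incl‖ := by
  rcases eq_or_lt_of_le (norm_nonneg U.incl) with h0 | h0
  · rw [← h0, mul_zero]
    exact norm_nonneg _
  refine le_of_mul_le_mul_right ?_ h0
  have h1 := DomA.dissipative U
  have h2 : (inner ℂ U.incl (U.gen - z • U.incl)).im =
      (inner ℂ U.incl U.gen).im - z.im * ‖U.incl‖ ^ 2 := by
    rw [inner_sub_right, inner_smul_right, inner_self_eq_norm_sq_to_K]
    change (_ - z * ((‖U.incl‖ : ℝ) : ℂ) ^ 2).im = _
    rw [← Complex.ofReal_pow, Complex.sub_im, Complex.im_mul_ofReal]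
  have h3 := (abs_le.mp (Complex.abs_im_le_norm (inner ℂ U.incl (U.gen - z • U.incl)))).1
  have h4 := norm_inner_le_norm (𝕜 := ℂ) U.incl (U.gen - z • U.incl)
  nlinarith

/-- The wave generator is closed. -/
theorem DomA.closed {U : ℕ → DomA M} {V W : Energy M}
    (hV : Tendsto (fun n => (U n).incl) atTop (𝓝 V))
    (hW : Tendsto (fun n => (U n).gen) atTop (𝓝 W)) :
    ∃ X : DomA M, X.incl = V ∧ X.gen = W := by
  have hfst : ∀ {Y : ℕ → Energy M} {Z : Energy M}, Tendsto Y atTop (𝓝 Z) →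
      Tendsto (fun n => (Y n).fst) atTop (𝓝 Z.fst) := fun {_ Z} h =>
    ((WithLp.prod_continuous_ofLp 2 (HDot M) (L2 d)).fst.tendsto Z).comp h
  have hsnd : ∀ {Y : ℕ → Energy M} {Z : Energy M}, Tendsto Y atTop (𝓝 Z) →
      Tendsto (fun n => (Y n).snd) atTop (𝓝 Z.snd) := fun {_ Z} h =>
    ((WithLp.prod_continuous_ofLp 2 (HDot M) (L2 d)).snd.tendsto Z).comp h
  have h1 : W.fst.dist = l2Emb d V.snd := by
    have e1 := HDot.tendsto_dist (hfst hW)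
    have e2 := (continuous_l2Emb.tendsto V.snd).comp (hsnd hV)
    exact tendsto_nhds_unique e1 (e2.congr fun n => ((U n).gen_fst_dist).symm)
  have h2 : M.H0 V.fst.dist = l2Emb d (W.snd + Complex.I • M.mulA V.snd) := by
    have e1 := (M.H0.continuous.tendsto _).comp (HDot.tendsto_dist (hfst hV))
    have hc : Continuous fun v : L2 d => Complex.I • M.mulA v := by fun_prop
    have e2 := (continuous_l2Emb.tendsto _).comp
      ((hsnd hW).add ((hc.tendsto V.snd).comp (hsnd hV)))
    refine tendsto_nhds_unique e1 (e2.congr fun n => ?_)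
    change l2Emb d ((U n).gen.snd + Complex.I • M.mulA (U n).incl.snd) = M.H0 (U n).incl.fst.dist
    rw [map_add, DomA.l2Emb_gen_snd, sub_add_cancel]
  -- The limit equations themselves supply the domain conditions: `V.snd` agrees with `W.fst`, which
  -- is in `Ḣ¹`, and `H₀ V.fst` is in `L²`.
  let X : DomA M := ⟨V, h1 ▸ W.fst.dist_mem, _, h2.symm⟩
  have hX : X.incl = V := rfl
  refine ⟨X, hX, Energy.ext' ?_ (l2Emb_injective d ?_)⟩
  · rw [X.gen_fst_dist, hX, h1]
  · rw [X.l2Emb_gen_snd, hX, h2, map_add, add_sub_cancel_right]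

theorem l2Emb_mem_hdot_of_memSobolev {u : L2 d} (h : MemSobolev 2 2 (l2Emb d u)) :
    l2Emb d u ∈ hdot d := by
  choose g hg using fun j : Fin d =>
    mem_range_of_memSobolev (by norm_num) (h.lineDerivOp (m := basisVec j))
  exact mem_hdot_of_H1 (g := WithLp.toLp 2 g) fun j => (hg j).symm

/-- The first row of `(𝒜 - z)(u, v) = (f, g)` gives `v = f + zu`; the second then reads `(H₀ - iza -
z²)u = iaf + zf + g`. Since `u` is in `H²` and `f` is Schwartz, both `u` and `v` lie in `Ḣ¹`. -/
theorem exists_isMatrixProduct {z : ℂ} (hz : 0 < z.im) (f g : 𝓢(Space d, ℂ)) :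
    ∃ W : DomA M, M.IsMatrixProduct z f g W ∧ W.gen - z • W.incl = schwartzPair M f g := by
  obtain ⟨f', hf'⟩ : ∃ f' : L2 d, schwartzL2 d f = f' := ⟨_, rfl⟩
  obtain ⟨g', hg'⟩ : ∃ g' : L2 d, schwartzL2 d g = g' := ⟨_, rfl⟩
  obtain ⟨u, hu⟩ : ∃ u, u = M.R z (Complex.I • M.mulA f' + z • f') + M.R z g' := ⟨_, rfl⟩
  have hinv := (M.isInverse_R hz ((Complex.I • M.mulA f' + z • f') + g') u).mp
    (by rw [hu, map_add])
  obtain ⟨hu2, heq⟩ := hinv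
  have heq' : M.H0 (l2Emb d u) = l2Emb d (((Complex.I • M.mulA f' + z • f') + g') +
      ((Complex.I * z) • M.mulA u + z ^ 2 • u)) := by
    rw [map_add]
    exact sub_eq_iff_eq_add.mp heq
  have hu1 : l2Emb d u ∈ hdot d := l2Emb_mem_hdot_of_memSobolev hu2
  have hfd : l2Emb d f' = (f : 𝓢'(Space d, ℂ)) := by rw [← hf', l2Emb_schwartzL2]
  have hv1 : l2Emb d (f' + z • u) ∈ hdot d := by
    rw [map_add, map_smul, hfd]
    exact add_mem (schwartz_mem_hdot f) ((hdot d).smul_mem z hu1)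
  let W : DomA M := ⟨WithLp.toLp 2 ((⟨l2Emb d u, hu1⟩ : hdot d), f' + z • u), hv1, _, heq'.symm⟩
  have hW1 : W.incl.fst.dist = l2Emb d u := rfl
  have hW2 : W.incl.snd = f' + z • u := rfl
  refine ⟨W, ⟨?_, ?_⟩, Energy.ext' ?_ (l2Emb_injective d ?_)⟩
  · change l2Emb d u = l2Emb d (M.R z (Complex.I • M.mulA (schwartzL2 d f) +
      z • schwartzL2 d f) + M.R z (schwartzL2 d g))
    rw [hf', hg', ← hu]
  · change f' + z • u = schwartzL2 d f + M.R z ((z * Complex.I) • M.mulA (schwartzL2 d f) +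
      z ^ 2 • schwartzL2 d f) + z • M.R z (schwartzL2 d g)
    rw [hf', hg', hu]
    have : (z * Complex.I) • M.mulA f' + z ^ 2 • f' = z • (Complex.I • M.mulA f' + z • f') := by
      rw [smul_add, smul_smul, smul_smul, sq]
    rw [this, map_smul, smul_add, add_assoc]
  · change (W.gen.fst - z • W.incl.fst).dist = (f : 𝓢'(Space d, ℂ))
    rw [map_sub, map_smul, W.gen_fst_dist, hW1, hW2, map_add, map_smul, add_sub_cancel_right, hfd]
  · change l2Emb d (W.gen.snd - z • W.incl.snd) = l2Emb d (schwartzL2 d g)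
    rw [map_sub, W.l2Emb_gen_snd, hW1, heq', ← map_sub, ← map_sub, hW2, hg']
    congr 1
    simp only [map_add, map_smul]
    module

/-- The range contains `𝓢 × 𝓢`, hence is dense. The lower bound makes the preimages of a convergent
sequence Cauchy, and closedness of `𝒜` identifies their limit. -/
theorem DomA.exists_gen_sub_eq {z : ℂ} (hz : 0 < z.im) (F : Energy M) :
    ∃ U : DomA M, U.gen - z • U.incl = F := by
  obtain ⟨f, g, hF⟩ := exists_schwartzPair_tendsto F
  choose U _ hU using fun n => exists_isMatrixProduct (M := M) hz (f n) (g n)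
  have hcau : CauchySeq fun n => (U n).incl := by
    have h1 := hF.cauchySeq
    rw [cauchySeq_iff_tendsto_dist_atTop_0] at h1 ⊢
    have h2 := h1.const_mul z.im⁻¹
    rw [mul_zero] at h2
    refine squeeze_zero (fun _ => dist_nonneg) (fun n => ?_) h2
    have h3 := DomA.im_mul_norm_incl_le z (U n.1 - U n.2)
    have h4 : (U n.1 - U n.2).gen - z • (U n.1 - U n.2).incl =
        schwartzPair M (f n.1) (g n.1) - schwartzPair M (f n.2) (g n.2) := by
      rw [← hU, ← hU, map_sub, map_sub, smul_sub]
      abel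
    rw [h4, map_sub, ← dist_eq_norm, ← dist_eq_norm] at h3
    rw [inv_mul_eq_div, le_div_iff₀ hz]
    linarith
  obtain ⟨V, hV⟩ := cauchySeq_tendsto_of_complete hcau
  have hgen : Tendsto (fun n => (U n).gen) atTop (𝓝 (F + z • V)) :=
    (hF.add (hV.const_smul z)).congr fun n => by rw [← hU, sub_add_cancel]
  obtain ⟨X, hX1, hX2⟩ := DomA.closed hV hgen
  exact ⟨X, by rw [hX1, hX2, add_sub_cancel_right]⟩

/-- The norm of the domain is controlled by the graph norm: `v` in `Ḣ¹` is the first component of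
`𝒜U`, and `H₀u` is the second one plus the bounded term `iav`. -/
theorem DomA.norm_le (U : DomA M) : ‖U‖ ≤ (1 + ‖M.mulA‖) * ‖U.incl‖ + 2 * ‖U.gen‖ := by
  have hfst : ∀ W : Energy M, ‖W.fst‖ ≤ ‖W‖ := fun W => WithLp.norm_fst_le _ W
  have hsnd : ∀ W : Energy M, ‖W.snd‖ ≤ ‖W‖ := fun W => WithLp.norm_snd_le _ W
  have h1 : U.vHDot = U.gen.fst := rfl
  have h2 : U.h0 = U.gen.snd + Complex.I • M.mulA U.incl.snd := by
    rw [U.gen_snd, sub_add_cancel]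
  have h3 : ‖U.h0‖ ≤ ‖U.gen‖ + ‖M.mulA‖ * ‖U.incl‖ := by
    rw [h2]
    refine (norm_add_le _ _).trans (add_le_add (hsnd _) ?_)
    rw [norm_smul, Complex.norm_I, one_mul]
    exact (M.mulA.le_opNorm _).trans (mul_le_mul_of_nonneg_left (hsnd _) (norm_nonneg _))
  rw [DomA.norm_eq, h1]
  linarith [hfst U.gen]

theorem DomA.exists_resolvent {z : ℂ} (hz : 0 < z.im) : ∃ RA : Energy M →L[ℂ] DomA M,
    (∀ F : Energy M, (RA F).gen - z • (RA F).incl = F) ∧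
    (∀ U : DomA M, RA (U.gen - z • U.incl) = U) := by
  let T : DomA M →ₗ[ℂ] Energy M := DomA.gen - z • DomA.incl
  have hT : ∀ U, T U = U.gen - z • U.incl := fun U => rfl
  have hbij : Function.Bijective T := by
    refine ⟨(injective_iff_map_eq_zero T).mpr fun U hU => ?_, DomA.exists_gen_sub_eq hz⟩
    have h1 := DomA.im_mul_norm_incl_le z U
    rw [← hT, hU, norm_zero] at h1
    apply DomA.incl_injective
    rw [map_zero, ← norm_eq_zero]
    nlinarith [norm_nonneg U.incl]
  let e := LinearEquiv.ofBijective T hbij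
  have he : ∀ F, (e.symm F).gen - z • (e.symm F).incl = F := e.apply_symm_apply
  refine ⟨e.symm.toLinearMap.mkContinuous
    ((1 + ‖M.mulA‖) * z.im⁻¹ + 2 * (1 + ‖z‖ * z.im⁻¹)) fun F => ?_, he, e.symm_apply_apply⟩
  have h1 := DomA.im_mul_norm_incl_le z (e.symm F)
  rw [he] at h1
  have h2 : ‖(e.symm F).incl‖ ≤ z.im⁻¹ * ‖F‖ := by
    rw [inv_mul_eq_div, le_div_iff₀ hz]
    linarith
  have h3 : ‖(e.symm F).gen‖ ≤ ‖F‖ + ‖z‖ * (z.im⁻¹ * ‖F‖) := by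
    have h4 : (e.symm F).gen = F + z • (e.symm F).incl :=
      sub_eq_iff_eq_add.mp (he F)
    rw [h4]
    refine (norm_add_le _ _).trans (add_le_add_right ?_ _)
    rw [norm_smul]
    exact mul_le_mul_of_nonneg_left h2 (norm_nonneg _)
  have h5 := mul_le_mul_of_nonneg_left h2 (by positivity : 0 ≤ 1 + ‖M.mulA‖)
  have h6 := DomA.norm_le (e.symm F)
  change ‖e.symm F‖ ≤ _
  linarith

theorem isMatrixProduct_unique {z : ℂ} {f g : 𝓢(Space d, ℂ)} {W W' : DomA M}
    (h : M.IsMatrixProduct z f g W) (h' : M.IsMatrixProduct z f g W') : W = W' :=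
  DomA.incl_injective (Energy.ext' (h.1.trans h'.1.symm) (h.2.trans h'.2.symm))

/-- The graph of a continuous map is closed, and density of `𝓢 × 𝓢` in `ℋ` makes the restricted
graph dense in it. -/
theorem closure_matrixGraph {z : ℂ} {RA : Energy M →L[ℂ] DomA M}
    (h : ∀ f g : 𝓢(Space d, ℂ), M.IsMatrixProduct z f g (RA (schwartzPair M f g))) :
    closure (M.matrixGraph z) = {p | p.2 = RA p.1} := by
  apply subset_antisymm
  · refine closure_minimal ?_ (isClosed_eq continuous_snd (RA.continuous.comp continuous_fst))
    rintro ⟨F, W⟩ ⟨f, g, rfl, hW⟩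
    exact isMatrixProduct_unique hW (h f g)
  · rintro ⟨F, W⟩ hW
    obtain rfl : W = RA F := hW
    obtain ⟨f, g, hF⟩ := exists_schwartzPair_tendsto F
    exact mem_closure_of_tendsto (hF.prodMk_nhds ((RA.continuous.tendsto F).comp hF))
      (Eventually.of_forall fun n => ⟨f n, g n, rfl, h (f n) (g n)⟩)

theorem isMaximalDissipative_waveGen (M : Medium d) : IsMaximalDissipative (waveGen M) := by
  refine ⟨isDissipative_waveGen M, fun S hS hle => ?_⟩
  refine (LinearPMap.eq_of_le_of_domain_eq hle (le_antisymm hle.1 fun φ hφ => ?_)).symm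
  -- For `φ` in the domain of the extension `S`, choose `U` with `(𝒜 - i)U = (S - i)φ`. Then `w = φ
  -- - U` satisfies `S w = i w`, so dissipativity reads `‖w‖² ≤ 0` and `φ = U` is in the domain of
  -- `𝒜`.
  obtain ⟨U, hU⟩ := DomA.exists_gen_sub_eq (M := M) (z := Complex.I) (by simp)
    (S ⟨φ, hφ⟩ - Complex.I • φ)
  let ψ : S.domain := ⟨U.incl, hle.1 U.2⟩
  have hψ : S ψ = U.gen := (hle.2 (x := U) (y := ψ) rfl).symm
  have h1 : S (⟨φ, hφ⟩ - ψ) = Complex.I • (φ - U.incl) := by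
    rw [LinearPMap.map_sub, hψ, smul_sub, sub_eq_sub_iff_add_eq_add]
    rw [sub_eq_sub_iff_add_eq_add] at hU
    rw [← hU]
    abel
  have h2 := hS (⟨φ, hφ⟩ - ψ)
  rw [h1] at h2
  change (inner ℂ (φ - U.incl) (Complex.I • (φ - U.incl))).im ≤ 0 at h2
  rw [inner_smul_right, inner_self_eq_norm_sq_to_K] at h2
  change (Complex.I * ((‖φ - U.incl‖ : ℝ) : ℂ) ^ 2).im ≤ 0 at h2
  rw [← Complex.ofReal_pow, Complex.im_mul_ofReal, Complex.I_im, one_mul] at h2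
  have h3 : φ - U.incl = 0 := by
    rw [← norm_eq_zero]
    exact pow_eq_zero_iff two_ne_zero |>.mp (le_antisymm h2 (sq_nonneg _))
  rw [sub_eq_zero.mp h3]
  exact U.2

end Generator

end DampedWave

end

theorem proposition3p5 {d : ℕ} [Fact (3 ≤ d)] (M : Medium d) :
    -- `ℋ` is the Hilbert completion of `𝓢 × 𝓢`
    (CompleteSpace (Energy M) ∧
      Dense {U : Energy M | ∃ f g : 𝓢(Space d, ℂ), U = schwartzPair M f g}) ∧
    (∀ z : ℂ, 0 < z.im →
      -- `R(z)` is well defined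
      M.IsInverse z (M.R z) ∧
      ∃ RA : Energy M →L[ℂ] DomA M,
        -- `RA` is the closure of the operator defined by the matrix on `𝓢 × 𝓢`
        (∀ f g : 𝓢(Space d, ℂ), M.IsMatrixProduct z f g (RA (schwartzPair M f g))) ∧
        closure (M.matrixGraph z) = {p | p.2 = RA p.1} ∧
        -- `RA` is the two-sided inverse of `𝒜 - z`
        (∀ F : Energy M, (RA F).gen - z • (RA F).incl = F) ∧
        (∀ U : DomA M, RA (U.gen - z • U.incl) = U)) ∧
    IsMaximalDissipative (waveGen M) := by
  refine ⟨⟨inferInstance, dense_schwartzPair M⟩, fun z hz => ⟨M.isInverse_R hz, ?_⟩,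
    isMaximalDissipative_waveGen M⟩
  obtain ⟨RA, h1, h2⟩ := DomA.exists_resolvent (M := M) hz
  have h3 : ∀ f g, M.IsMatrixProduct z f g (RA (schwartzPair M f g)) := fun f g => by
    obtain ⟨W, hW, hW2⟩ := exists_isMatrixProduct (M := M) hz f g
    -- The left inverse identity recognises the explicit matrix solution `W` as the value of the
    -- abstract inverse.
    rw [← hW2, h2]
    exact hW
  exact ⟨RA, h3, closure_matrixGraph h3, h1, h2⟩
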